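/- Let $N\ge 1$, $\Delta\ge 0$ and $T$ be real numbers, let $1\le t_1,\dots,t_R\le T$ be real numbers that are well spaced, i.e. $|t_r-t_s|\ge 1$ for $r\ne s$, let $\gamma(t_1),\dots,\gamma(t_R)$ be positive real numbers and let $(a_n)$ be a sequence of complex numbers with $|a_n|\le 1$. Put $$S(N,\Delta,\gamma)=\sum_{\substack{1\le r,s\le R\\ |t_r-t_s|\le\Delta}}\gamma(t_r)\gamma(t_s)\Bigl|\sum_{N\le n\le 2N}a_n n^{-1/2+i(t_r-t_s)}\Bigr|^2,$$ $$I(\Delta,\gamma)=\sum_{\substack{1\le r,s\le R\\ |t_r-t_s|\le\Delta}}\gamma(t_r)\gamma(t_s),\qquad \|\gamma\|_2=\Bigl(\sum_{r=1}^R\gamma(t_r)^2\Bigr)^{1/2}.$$ Then for every $\varepsilon>0$ there is a constant $C>0$ depending only on $\varepsilon$ (and not on $N,\Delta,T,R$, the $t_r$, $\gamma$ or the $a_n$) such that the following holds. If $N\ge\Delta^{2/3}$, then $$S(N,\Delta,\gamma)\le C N^{\varepsilon}\bigl(I(\Delta,\gamma)+N\|\gamma\|_2^2\bigr),$$ and in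 general $$S(N,\Delta,\gamma)\le C (NT)^{\varepsilon}\bigl(I(\Delta,\gamma)+N\|\gamma\|_2^2+\Delta^{1/2}I(\Delta,\gamma)^{1/4}\|\gamma\|_2^{3/2}\bigr).$$ -/

import Mathlib

noncomputable section

/-- The real sequence `t` is well spaced: distinct terms are at distance at least `1`. -/
def WellSpaced {R : ℕ} (t : Fin R → ℝ) : Prop :=
  ∀ r s : Fin R, r ≠ s → 1 ≤ |t r - t s|

/-- The Dirichlet polynomial `∑_{N ≤ n ≤ 2N} a_n n^{-1/2 + i t}`, for real `N`. -/
def dirichletPoly (a : ℕ → ℂ) (N t : ℝ) : ℂ :=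
  ∑ n ∈ Finset.Icc ⌈N⌉₊ ⌊2 * N⌋₊, a n * (n : ℂ) ^ (-(1 / 2 : ℂ) + Complex.I * (t : ℂ))

/-- `S(N, Δ, γ)`, with coefficients `a`: the sum over the pairs `(r, s)` with `|t_r - t_s| ≤ Δ` of
`γ(t_r) γ(t_s) |∑_{N ≤ n ≤ 2N} a_n n^{-1/2 + i (t_r - t_s)}|²`. -/
def localizedSum {R : ℕ} (a : ℕ → ℂ) (N Δ : ℝ) (t γ : Fin R → ℝ) : ℝ :=
  ∑ p : Fin R × Fin R with |t p.1 - t p.2| ≤ Δ,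
    γ p.1 * γ p.2 * ‖dirichletPoly a N (t p.1 - t p.2)‖ ^ 2

/-- `I(Δ, γ)`: the sum of `γ(t_r) γ(t_s)` over the pairs `(r, s)` with `|t_r - t_s| ≤ Δ`. -/
def localizedCount {R : ℕ} (Δ : ℝ) (t γ : Fin R → ℝ) : ℝ :=
  ∑ p : Fin R × Fin R with |t p.1 - t p.2| ≤ Δ, γ p.1 * γ p.2

/-- The `ℓ²` norm of the weights. -/
def l2Norm {R : ℕ} (γ : Fin R → ℝ) : ℝ :=
  Real.sqrt (∑ r, γ r ^ 2)

end

/-! Let A be a set of points of diameter at most Δ, and write G = ∑ γ_r, Q = ∑ γ_r², W =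
`weightSum`, H(K) = `zetaEnergy`. Opening the square turns an energy into ∑_{m,n} c_m conj(c_n)
|W(log m - log n)|². The last factor is nonnegative, so an energy only grows when the coefficients
are replaced by majorants and the range is enlarged (`crossEnergy_mono`). Hence the a_n can be
dropped and H is monotone. Cutting the t_r into windows of length max(Δ, 1) reduces everything to
H(2N) on one window (`localizedSum_le_sum_window`).

Up to factors of size ε in the exponent, two inequalities drive the bound for H. Squaring
(`zetaEnergy_sq_le`): H(K)² ≪ G² H(K²), by Cauchy-Schwarz and the divisor bound. Duality
(`exists_zetaEnergy_dual`): H(M) ≪ M Q + H(24Δ/M) if 4Δ ≤ M². For duality no functional equation is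
used. First H(M) is bounded by the energy of one block [P, 4P]. That energy is at most about Δ/P
times the integral of |W(u)|² against the number of pairs (m, n) of the block with log(m/n) within
1/Δ of u. Such pairs are lattice points in a thin parallelogram: beyond the expected O(P²/Δ) there
are only those on a long progression, whose direction is a rational j/k near e^u of height O(Δ/P).
The expected part gives P Q by the mean value theorem, and the rationals reassemble into H(12Δ/P).

If M³ ≥ (24Δ)², the dual length K = 24Δ/M has K² ≤ M, so the two inequalities close up: H(M) ≪ M Q +
G H(M)^{1/2}, whence H(M) ≪ G² + M Q. For smaller M this long bound is inserted into H(K)² ≪ G²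
H(K²), and M ≥ 2N is then optimized, which produces the term Δ^{1/2} G^{1/2} Q^{3/4}. Hölder's
inequality sums that term over the windows. -/

/-! ### Energies as positive quadratic forms; the majorant principle -/

section Energy

variable {ι : Type*}

/-- The generalized Dirichlet polynomial `∑_{r ∈ A} γ_r e^{i u t_r}`. -/
noncomputable def weightSum (A : Finset ι) (t γ : ι → ℝ) (u : ℝ) : ℂ :=
  ∑ r ∈ A, (γ r : ℂ) * Complex.exp ((u * t r : ℝ) * Complex.I)

/-- The Dirichlet polynomial `∑_{n ∈ X} c_n n^{i τ}`. -/
noncomputable def twistSum (X : Finset ℕ) (c : ℕ → ℂ) (τ : ℝ) : ℂ :=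
  ∑ n ∈ X, c n * Complex.exp ((τ * Real.log n : ℝ) * Complex.I)

/-- The sum of `γ_r γ_s |∑_{n ∈ X} c_n n^{i (t_r - t_s)}|²` over `r ∈ A`, `s ∈ B`. -/
noncomputable def crossEnergy (A B : Finset ι) (t γ : ι → ℝ) (X : Finset ℕ) (c : ℕ → ℂ) : ℝ :=
  ∑ r ∈ A, ∑ s ∈ B, γ r * γ s * ‖twistSum X c (t r - t s)‖ ^ 2

/-- The coefficients `n^{-1/2}`. -/
noncomputable def invSqrt (n : ℕ) : ℝ := (Real.sqrt n)⁻¹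

lemma invSqrt_nonneg (n : ℕ) : 0 ≤ invSqrt n := by unfold invSqrt; positivity

/-- The energy of the partial sum `∑_{n ≤ K} n^{-1/2 + i τ}` of the zeta function. -/
noncomputable def zetaEnergy (A : Finset ι) (t γ : ι → ℝ) (K : ℝ) : ℝ :=
  crossEnergy A A t γ (Finset.Icc 1 ⌊K⌋₊) (fun n => (invSqrt n : ℂ))

variable {A B : Finset ι} {t γ : ι → ℝ}

lemma sq_norm_twistSum (X : Finset ℕ) (c : ℕ → ℂ) (τ : ℝ) :
    ((‖twistSum X c τ‖ ^ 2 : ℝ) : ℂ) = ∑ m ∈ X, ∑ n ∈ X, c m * (starRingEnd ℂ) (c n) *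
      Complex.exp ((τ * (Real.log m - Real.log n) : ℝ) * Complex.I) := by
  have h := Complex.mul_conj' (twistSum X c τ)
  push_cast
  rw [← h]
  unfold twistSum
  rw [map_sum, Finset.sum_mul_sum]
  refine Finset.sum_congr rfl fun m _ => Finset.sum_congr rfl fun n _ => ?_
  rw [map_mul, ← Complex.exp_conj, map_mul, Complex.conj_I, Complex.conj_ofReal,
    mul_mul_mul_comm, ← Complex.exp_add]
  congr 2
  push_cast
  ring

lemma weightSum_mul_conj (A B : Finset ι) (t γ : ι → ℝ) (u : ℝ) :
    weightSum A t γ u * (starRingEnd ℂ) (weightSum B t γ u) =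
      ∑ r ∈ A, ∑ s ∈ B, (γ r * γ s : ℂ) * Complex.exp ((u * (t r - t s) : ℝ) * Complex.I) := by
  unfold weightSum
  rw [map_sum, Finset.sum_mul_sum]
  refine Finset.sum_congr rfl fun m _ => Finset.sum_congr rfl fun n _ => ?_
  rw [map_mul, ← Complex.exp_conj, map_mul, Complex.conj_I, Complex.conj_ofReal,
    Complex.conj_ofReal, mul_mul_mul_comm, ← Complex.exp_add]
  congr 2
  push_cast
  ring

/-- After interchanging the sums, the phase exp(i v (t_r - t_s)) is a translation by v of the
argument of both weight sums. -/
lemma crossEnergy_shift (A B : Finset ι) (t γ : ι → ℝ) (X : Finset ℕ) (c : ℕ → ℂ) (v : ℝ) :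
    ∑ r ∈ A, ∑ s ∈ B, (γ r * γ s : ℂ) * Complex.exp ((v * (t r - t s) : ℝ) * Complex.I) *
        ((‖twistSum X c (t r - t s)‖ ^ 2 : ℝ) : ℂ) =
      ∑ m ∈ X, ∑ n ∈ X, c m * (starRingEnd ℂ) (c n) *
        (weightSum A t γ (Real.log m - Real.log n + v) *
          (starRingEnd ℂ) (weightSum B t γ (Real.log m - Real.log n + v))) := by
  simp_rw [weightSum_mul_conj, sq_norm_twistSum, Finset.mul_sum]
  have h1 : ∀ r ∈ A, ∑ s ∈ B, ∑ m ∈ X, ∑ n ∈ X, (γ r * γ s : ℂ) *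
      Complex.exp ((v * (t r - t s) : ℝ) * Complex.I) * (c m * (starRingEnd ℂ) (c n) *
      Complex.exp (((t r - t s) * (Real.log m - Real.log n) : ℝ) * Complex.I)) =
      ∑ m ∈ X, ∑ n ∈ X, ∑ s ∈ B, (γ r * γ s : ℂ) *
      Complex.exp ((v * (t r - t s) : ℝ) * Complex.I) * (c m * (starRingEnd ℂ) (c n) *
      Complex.exp (((t r - t s) * (Real.log m - Real.log n) : ℝ) * Complex.I)) := by
    intro r _
    rw [Finset.sum_comm]
    exact Finset.sum_congr rfl fun m _ => Finset.sum_comm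
  rw [Finset.sum_congr rfl h1, Finset.sum_comm]
  refine Finset.sum_congr rfl fun m _ => ?_
  rw [Finset.sum_comm]
  refine Finset.sum_congr rfl fun n _ => Finset.sum_congr rfl fun r _ =>
    Finset.sum_congr rfl fun s _ => ?_
  have : Complex.exp (((Real.log m - Real.log n + v) * (t r - t s) : ℝ) * Complex.I) =
      Complex.exp ((v * (t r - t s) : ℝ) * Complex.I) *
        Complex.exp (((t r - t s) * (Real.log m - Real.log n) : ℝ) * Complex.I) := by
    rw [← Complex.exp_add]
    congr 1
    push_cast
    ring
  rw [this]
  ring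

/-- For real coefficients, translating the argument of `weightSum` twists the energy. -/
lemma sum_norm_weightSum_shift (A : Finset ι) (t γ : ι → ℝ) (X : Finset ℕ) (b : ℕ → ℝ) (v : ℝ) :
    ∑ m ∈ X, ∑ n ∈ X, b m * b n * ‖weightSum A t γ (Real.log m - Real.log n + v)‖ ^ 2 =
      ∑ r ∈ A, ∑ s ∈ A, γ r * γ s * Real.cos (v * (t r - t s)) *
        ‖twistSum X (fun n => (b n : ℂ)) (t r - t s)‖ ^ 2 := by
  have h := crossEnergy_shift A A t γ X (fun n => (b n : ℂ)) v
  have h2 := congrArg Complex.re h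
  simp only [Complex.re_sum] at h2
  have hl : ∀ r s : ι, ((γ r * γ s : ℂ) * Complex.exp ((v * (t r - t s) : ℝ) * Complex.I) *
        ((‖twistSum X (fun n => (b n : ℂ)) (t r - t s)‖ ^ 2 : ℝ) : ℂ)).re =
      γ r * γ s * Real.cos (v * (t r - t s)) *
        ‖twistSum X (fun n => (b n : ℂ)) (t r - t s)‖ ^ 2 := by
    intro r s
    rw [Complex.re_mul_ofReal, ← Complex.ofReal_mul, Complex.re_ofReal_mul,
      Complex.exp_ofReal_mul_I_re]
  have hr : ∀ m n : ℕ, ((b m : ℂ) * (starRingEnd ℂ) (b n : ℂ) *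
        (weightSum A t γ (Real.log m - Real.log n + v) *
          (starRingEnd ℂ) (weightSum A t γ (Real.log m - Real.log n + v)))).re =
      b m * b n * ‖weightSum A t γ (Real.log m - Real.log n + v)‖ ^ 2 := by
    intro m n
    rw [Complex.conj_ofReal, Complex.mul_conj', ← Complex.ofReal_mul, Complex.re_ofReal_mul,
      ← Complex.ofReal_pow, Complex.ofReal_re]
  simp only [hl, hr] at h2
  exact h2.symm

lemma crossEnergy_eq_sum (A : Finset ι) (t γ : ι → ℝ) (X : Finset ℕ) (b : ℕ → ℝ) :
    crossEnergy A A t γ X (fun n => (b n : ℂ)) =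
      ∑ m ∈ X, ∑ n ∈ X, b m * b n * ‖weightSum A t γ (Real.log m - Real.log n)‖ ^ 2 := by
  have h := sum_norm_weightSum_shift A t γ X b 0
  simp only [add_zero, zero_mul, Real.cos_zero, mul_one] at h
  rw [h]
  rfl

/-- The majorant principle: |W_A conj W_B| ≤ (|W_A|² + |W_B|²)/2, and the resulting form has
nonnegative terms b_m b_n |W|². Two different sets are allowed in order to treat pairs straddling
neighbouring windows. -/
lemma crossEnergy_le_half_add {X Y : Finset ℕ} {a : ℕ → ℂ} {b : ℕ → ℝ}
    (hXY : X ⊆ Y) (hab : ∀ n ∈ X, ‖a n‖ ≤ b n) (hb : ∀ n, 0 ≤ b n) :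
    crossEnergy A B t γ X a ≤ (crossEnergy A A t γ Y (fun n => (b n : ℂ)) +
      crossEnergy B B t γ Y (fun n => (b n : ℂ))) / 2 := by
  have h := crossEnergy_shift A B t γ X a 0
  simp only [zero_mul, Complex.ofReal_zero, Complex.exp_zero, mul_one, add_zero] at h
  have h1 : ((crossEnergy A B t γ X a : ℝ) : ℂ) = ∑ r ∈ A, ∑ s ∈ B, (γ r * γ s : ℂ) *
        ((‖twistSum X a (t r - t s)‖ ^ 2 : ℝ) : ℂ) := by
    unfold crossEnergy
    push_cast
    rfl
  rw [← h1] at h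
  have h2 : crossEnergy A B t γ X a ≤ ‖((crossEnergy A B t γ X a : ℝ) : ℂ)‖ := by
    rw [Complex.norm_real]
    exact le_abs_self _
  refine h2.trans ?_
  rw [h, crossEnergy_eq_sum, crossEnergy_eq_sum, ← Finset.sum_add_distrib, Finset.sum_div]
  refine (norm_sum_le _ _).trans ((Finset.sum_le_sum fun m hm => norm_sum_le _ _).trans ?_)
  have key : ∀ m n : ℕ, 0 ≤ (b m * b n * ‖weightSum A t γ (Real.log m - Real.log n)‖ ^ 2 +
      b m * b n * ‖weightSum B t γ (Real.log m - Real.log n)‖ ^ 2) / 2 := by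
    intro m n
    have := mul_nonneg (hb m) (hb n)
    positivity
  simp_rw [← Finset.sum_add_distrib, Finset.sum_div]
  refine (Finset.sum_le_sum fun m hm => Finset.sum_le_sum fun n hn => ?_).trans
    ((Finset.sum_le_sum fun m _ => Finset.sum_le_sum_of_subset_of_nonneg hXY
      fun n _ _ => key m n).trans
    (Finset.sum_le_sum_of_subset_of_nonneg hXY fun m _ _ => Finset.sum_nonneg fun n _ => key m n))
  rw [norm_mul, norm_mul, norm_mul, RCLike.norm_conj, RCLike.norm_conj]
  set x := ‖weightSum A t γ (Real.log m - Real.log n)‖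
  set y := ‖weightSum B t γ (Real.log m - Real.log n)‖
  have h3 : ‖a m‖ * ‖a n‖ ≤ b m * b n :=
    mul_le_mul (hab m hm) (hab n hn) (norm_nonneg _) (hb m)
  calc ‖a m‖ * ‖a n‖ * (x * y) ≤ (b m * b n) * ((x ^ 2 + y ^ 2) / 2) := by
        refine mul_le_mul h3 ?_ (by positivity) (mul_nonneg (hb m) (hb n))
        nlinarith [sq_nonneg (x - y)]
    _ = _ := by ring

/-- Enlarging the set of summation and majorizing the coefficients increases the energy. -/
lemma crossEnergy_mono {X Y : Finset ℕ} {a : ℕ → ℂ} {b : ℕ → ℝ}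
    (hXY : X ⊆ Y) (hab : ∀ n ∈ X, ‖a n‖ ≤ b n) (hb : ∀ n, 0 ≤ b n) :
    crossEnergy A A t γ X a ≤ crossEnergy A A t γ Y (fun n => (b n : ℂ)) :=
  (crossEnergy_le_half_add hXY hab hb).trans_eq (by ring)

/-- A shift inserts cos(v(t_r - t_s)) ≤ 1 into a sum of nonnegative terms. -/
lemma sum_norm_weightSum_shift_le (hγ : ∀ r, 0 ≤ γ r) (X : Finset ℕ) (b : ℕ → ℝ) (v : ℝ) :
    ∑ m ∈ X, ∑ n ∈ X, b m * b n * ‖weightSum A t γ (Real.log m - Real.log n + v)‖ ^ 2 ≤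
      crossEnergy A A t γ X (fun n => (b n : ℂ)) := by
  rw [sum_norm_weightSum_shift]
  refine Finset.sum_le_sum fun r _ => Finset.sum_le_sum fun s _ => ?_
  have h1 := mul_nonneg (hγ r) (hγ s)
  exact mul_le_mul_of_nonneg_right (mul_le_of_le_one_right h1 (Real.cos_le_one _)) (by positivity)

/-- For |v| ≤ 1/Δ the inserted cosine has argument at most 1, so it is at least 1/2. This lets the
energy be averaged over v. -/
lemma crossEnergy_le_two_mul_shift (hγ : ∀ r, 0 ≤ γ r) (X : Finset ℕ) (b : ℕ → ℝ) {Δ v : ℝ}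
    (hΔ : 0 < Δ) (ht : ∀ r ∈ A, ∀ s ∈ A, |t r - t s| ≤ Δ) (hv : |v| ≤ 1 / Δ) :
    crossEnergy A A t γ X (fun n => (b n : ℂ)) ≤ 2 *
    ∑ m ∈ X, ∑ n ∈ X, b m * b n * ‖weightSum A t γ (Real.log m - Real.log n + v)‖ ^ 2 := by
  rw [sum_norm_weightSum_shift, Finset.mul_sum]
  refine Finset.sum_le_sum fun r hr => ?_
  rw [Finset.mul_sum]
  refine Finset.sum_le_sum fun s hs => ?_
  have h1 := mul_nonneg (hγ r) (hγ s)
  have h2 : |v * (t r - t s)| ≤ 1 := by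
    rw [abs_mul]
    calc |v| * |t r - t s| ≤ 1 / Δ * Δ :=
          mul_le_mul hv (ht r hr s hs) (abs_nonneg _) (by positivity)
      _ = 1 := by field_simp
  have h3 : 1 / 2 ≤ Real.cos (v * (t r - t s)) := by
    have h4 := Real.one_sub_sq_div_two_le_cos (x := v * (t r - t s))
    have h5 : (v * (t r - t s)) ^ 2 ≤ 1 := by
      rw [← sq_abs]
      exact pow_le_one₀ (abs_nonneg _) h2
    linarith
  have h6 : 0 ≤ γ r * γ s * ‖twistSum X (fun n => (b n : ℂ)) (t r - t s)‖ ^ 2 := by positivity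
  nlinarith

lemma crossEnergy_nonneg (hγ : ∀ r, 0 ≤ γ r) (X : Finset ℕ) (c : ℕ → ℂ) :
    0 ≤ crossEnergy A B t γ X c :=
  Finset.sum_nonneg fun r _ => Finset.sum_nonneg fun s _ =>
    mul_nonneg (mul_nonneg (hγ r) (hγ s)) (by positivity)

lemma zetaEnergy_nonneg (hγ : ∀ r, 0 ≤ γ r) (K : ℝ) : 0 ≤ zetaEnergy A t γ K :=
  crossEnergy_nonneg hγ _ _

lemma zetaEnergy_mono {K L : ℝ} (h : K ≤ L) : zetaEnergy A t γ K ≤ zetaEnergy A t γ L := by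
  refine crossEnergy_mono (Finset.Icc_subset_Icc_right (Nat.floor_le_floor h)) ?_ invSqrt_nonneg
  intro n _
  rw [Complex.norm_real, Real.norm_of_nonneg (invSqrt_nonneg n)]

end Energy

/-! ### The divisor bound -/

section DivisorBound

lemma natCast_add_one_le_mul_two_pow_rpow {ε : ℝ} (hε : 0 < ε) (k : ℕ) :
    (k + 1 : ℝ) ≤ (1 + 1 / (ε * Real.log 2)) * ((2 : ℝ) ^ k) ^ ε := by
  have hl : 0 < ε * Real.log 2 := mul_pos hε (Real.log_pos (by norm_num))
  have h1 : ((2 : ℝ) ^ k) ^ ε = Real.exp (k * (ε * Real.log 2)) := by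
    rw [Real.rpow_def_of_pos (by positivity), Real.log_pow]
    ring_nf
  rw [h1]
  have h2 := Real.add_one_le_exp (k * (ε * Real.log 2))
  have h3 : (1 : ℝ) ≤ Real.exp (k * (ε * Real.log 2)) := Real.one_le_exp (by positivity)
  have h4 : (k : ℝ) ≤ 1 / (ε * Real.log 2) * Real.exp (k * (ε * Real.log 2)) := by
    rw [div_mul_eq_mul_div, one_mul, le_div_iff₀ hl]
    linarith
  linarith

/-- The divisor bound `d(n) ≪ n^ε`. -/
lemma exists_card_divisors_le_rpow {ε : ℝ} (hε : 0 < ε) :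
    ∃ C : ℝ, 1 ≤ C ∧ ∀ n : ℕ, (n.divisors.card : ℝ) ≤ C * (n : ℝ) ^ ε := by
  -- Primes p ≥ P satisfy p^ε ≥ 2, so k + 1 ≤ 2^k ≤ p^{kε} costs no constant; only the primes below
  -- P each cost a factor `C₀`.
  obtain ⟨P, hP⟩ := exists_nat_gt ((2 : ℝ) ^ (1 / ε))
  set C₀ : ℝ := 1 + 1 / (ε * Real.log 2) with hC₀
  have hC₀1 : 1 ≤ C₀ := by
    have hl : 0 < ε * Real.log 2 := mul_pos hε (Real.log_pos (by norm_num))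
    have : 0 < 1 / (ε * Real.log 2) := by positivity
    linarith
  have key : ∀ n : ℕ, (n.divisors.card : ℝ) ≤
      C₀ ^ (n.primeFactors ∩ Finset.range P).card * (n : ℝ) ^ ε := by
    intro n
    induction n using Nat.recOnPosPrimePosCoprime with
    | prime_pow p k hp hk =>
      rw [Nat.divisors_prime_pow hp, Finset.card_map, Finset.card_range,
        Nat.primeFactors_prime_pow hk.ne' hp]
      push_cast
      have h2p : (2 : ℝ) ≤ p := by exact_mod_cast hp.two_le
      by_cases h : p < P
      · have : ({p} : Finset ℕ) ∩ Finset.range P = {p} :=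
          Finset.inter_eq_left.mpr (by simpa using h)
        rw [this, Finset.card_singleton, pow_one]
        refine (natCast_add_one_le_mul_two_pow_rpow hε k).trans ?_
        gcongr
      · have : ({p} : Finset ℕ) ∩ Finset.range P = ∅ := by
          ext x
          simp only [Finset.mem_inter, Finset.mem_singleton, Finset.mem_range,
            Finset.notMem_empty, iff_false]
          rintro ⟨rfl, h'⟩
          exact h h'
        rw [this, Finset.card_empty, pow_zero, one_mul]
        have h3 : (2 : ℝ) ≤ (p : ℝ) ^ ε := by
          have h4 : (2 : ℝ) ^ (1 / ε) ≤ p := hP.le.trans (by exact_mod_cast not_lt.mp h)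
          calc (2 : ℝ) = ((2 : ℝ) ^ (1 / ε)) ^ ε := by
                rw [← Real.rpow_mul (by norm_num)]; field_simp; simp
            _ ≤ _ := by gcongr
        rw [← Real.rpow_natCast, ← Real.rpow_mul (by positivity), mul_comm,
          Real.rpow_mul (by positivity), Real.rpow_natCast]
        have h5 : (k + 1 : ℝ) ≤ 2 ^ k := by exact_mod_cast Nat.lt_two_pow_self (n := k)
        exact h5.trans (pow_le_pow_left₀ (by norm_num) h3 k)
    | zero => simp [Real.zero_rpow hε.ne']
    | one => simp
    | coprime a b ha hb hab iha ihb =>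
      rw [Nat.Coprime.card_divisors_mul hab, Nat.Coprime.primeFactors_mul hab,
        Finset.union_inter_distrib_right, Finset.card_union_of_disjoint
          (hab.disjoint_primeFactors.mono Finset.inter_subset_left Finset.inter_subset_left)]
      push_cast
      rw [Real.mul_rpow (by positivity) (by positivity), pow_add]
      calc _ ≤ (C₀ ^ (a.primeFactors ∩ Finset.range P).card * (a : ℝ) ^ ε) *
            (C₀ ^ (b.primeFactors ∩ Finset.range P).card * (b : ℝ) ^ ε) := by gcongr
        _ = _ := by ring
  refine ⟨C₀ ^ P, one_le_pow₀ hC₀1, fun n => (key n).trans ?_⟩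
  gcongr
  exact (Finset.card_le_card Finset.inter_subset_right).trans_eq (Finset.card_range P)

end DivisorBound

/-! ### Products of Dirichlet polynomials -/

section Products

variable {ι : Type*} {A : Finset ι} {t γ : ι → ℝ}

/-- The Dirichlet convolution of two sequences supported on `X` and `Y`. -/
noncomputable def dirichletConv (X Y : Finset ℕ) (a b : ℕ → ℂ) (l : ℕ) : ℂ :=
  ∑ p ∈ X ×ˢ Y with p.1 * p.2 = l, a p.1 * b p.2

lemma twistSum_mul {X Y Z : Finset ℕ} {a b : ℕ → ℂ} (hX : ∀ n ∈ X, n ≠ 0) (hY : ∀ n ∈ Y, n ≠ 0)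
    (hZ : ∀ m ∈ X, ∀ n ∈ Y, m * n ∈ Z) (τ : ℝ) :
    twistSum X a τ * twistSum Y b τ = twistSum Z (dirichletConv X Y a b) τ := by
  unfold twistSum dirichletConv
  rw [Finset.sum_mul_sum, ← Finset.sum_product',
    ← Finset.sum_fiberwise_of_maps_to (s := X ×ˢ Y) (t := Z) (g := fun p => p.1 * p.2)]
  · refine Finset.sum_congr rfl fun l _ => ?_
    rw [Finset.sum_mul]
    refine Finset.sum_congr rfl fun p hp => ?_
    simp only [Finset.mem_filter, Finset.mem_product] at hp
    obtain ⟨⟨h1, h2⟩, rfl⟩ := hp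
    rw [mul_mul_mul_comm, ← Complex.exp_add, Nat.cast_mul, Real.log_mul
      (by exact_mod_cast hX _ h1) (by exact_mod_cast hY _ h2)]
    congr 2
    push_cast
    ring
  · intro p hp
    rw [Finset.mem_product] at hp
    exact hZ _ hp.1 _ hp.2

/-- Each factorization l = mn contributes at most (mn)^{-1/2} = l^{-1/2}, and there are at most d(l)
of them. -/
lemma norm_dirichletConv_le {X Y : Finset ℕ} {a b : ℕ → ℂ}
    (ha : ∀ n ∈ X, ‖a n‖ ≤ invSqrt n) (hb : ∀ n ∈ Y, ‖b n‖ ≤ invSqrt n) {l : ℕ} (hl : l ≠ 0) :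
    ‖dirichletConv X Y a b l‖ ≤ l.divisors.card * invSqrt l := by
  unfold dirichletConv
  refine (norm_sum_le _ _).trans ?_
  have h1 : ∀ p ∈ (X ×ˢ Y).filter (fun p => p.1 * p.2 = l), ‖a p.1 * b p.2‖ ≤ invSqrt l := by
    intro p hp
    simp only [Finset.mem_filter, Finset.mem_product] at hp
    obtain ⟨⟨h1, h2⟩, rfl⟩ := hp
    rw [norm_mul]
    refine (mul_le_mul (ha _ h1) (hb _ h2) (norm_nonneg _) (invSqrt_nonneg _)).trans_eq ?_
    unfold invSqrt
    rw [Nat.cast_mul, Real.sqrt_mul (by positivity), mul_inv]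
  refine (Finset.sum_le_card_nsmul _ _ _ h1).trans ?_
  rw [nsmul_eq_mul]
  refine mul_le_mul_of_nonneg_right ?_ (invSqrt_nonneg l)
  norm_cast
  refine Finset.card_le_card_of_injOn Prod.fst (fun p hp => ?_) (fun p hp q hq hpq => ?_)
  · simp only [Finset.coe_filter, Finset.mem_product, Set.mem_ofPred_eq] at hp
    exact Nat.mem_divisors.mpr ⟨⟨p.2, hp.2.symm⟩, hl⟩
  · simp only [Finset.coe_filter, Finset.mem_product, Set.mem_ofPred_eq] at hp hq
    refine Prod.ext hpq ?_
    have h0 : p.1 ≠ 0 := fun h => hl (by rw [← hp.2, h, zero_mul])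
    exact Nat.eq_of_mul_eq_mul_left (Nat.pos_of_ne_zero h0) (by rw [hp.2, hpq, hq.2])

lemma crossEnergy_const_mul (X : Finset ℕ) (b : ℕ → ℝ) (D : ℝ) :
    crossEnergy A A t γ X (fun n => ((D * b n : ℝ) : ℂ)) =
      D ^ 2 * crossEnergy A A t γ X (fun n => (b n : ℂ)) := by
  rw [crossEnergy_eq_sum, crossEnergy_eq_sum, Finset.mul_sum]
  refine Finset.sum_congr rfl fun m _ => ?_
  rw [Finset.mul_sum]
  refine Finset.sum_congr rfl fun n _ => ?_
  ring

/-- The energy of a product of two Dirichlet polynomials. -/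
lemma sum_mul_norm_twistSum_mul_le {X Y Z : Finset ℕ} {a b : ℕ → ℂ} {D : ℝ}
    (hX : ∀ n ∈ X, n ≠ 0) (hY : ∀ n ∈ Y, n ≠ 0)
    (hZ : ∀ m ∈ X, ∀ n ∈ Y, m * n ∈ Z) (hZ0 : ∀ n ∈ Z, n ≠ 0)
    (ha : ∀ n ∈ X, ‖a n‖ ≤ invSqrt n) (hb : ∀ n ∈ Y, ‖b n‖ ≤ invSqrt n)
    (hD0 : 0 ≤ D) (hD : ∀ n ∈ Z, (n.divisors.card : ℝ) ≤ D) :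
    ∑ r ∈ A, ∑ s ∈ A, γ r * γ s * ‖twistSum X a (t r - t s) * twistSum Y b (t r - t s)‖ ^ 2 ≤
      D ^ 2 * crossEnergy A A t γ Z (fun n => (invSqrt n : ℂ)) := by
  simp_rw [twistSum_mul hX hY hZ]
  rw [← crossEnergy_const_mul]
  refine crossEnergy_mono (b := fun n => D * invSqrt n) subset_rfl (fun n hn => ?_)
    (fun n => mul_nonneg hD0 (invSqrt_nonneg n))
  exact (norm_dirichletConv_le ha hb (hZ0 n hn)).trans
    (mul_le_mul_of_nonneg_right (hD n hn) (invSqrt_nonneg n))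

/-- Squaring: `H(K)² ≪ K^ε I H(K²)`. -/
lemma zetaEnergy_sq_le (hγ : ∀ r, 0 ≤ γ r) {K D : ℝ} (hK : 0 ≤ K) (hD0 : 0 ≤ D)
    (hD : ∀ n : ℕ, (n : ℝ) ≤ K ^ 2 → (n.divisors.card : ℝ) ≤ D) :
    zetaEnergy A t γ K ^ 2 ≤ (∑ r ∈ A, γ r) ^ 2 * (D ^ 2 * zetaEnergy A t γ (K ^ 2)) := by
  have h1 : ∀ n ∈ Finset.Icc 1 ⌊K⌋₊, n ≠ 0 := fun n hn => by
    have := (Finset.mem_Icc.mp hn).1; omega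
  have h2 : ∀ n ∈ Finset.Icc 1 ⌊K⌋₊, ‖(invSqrt n : ℂ)‖ ≤ invSqrt n := fun n _ => by
    rw [Complex.norm_real, Real.norm_of_nonneg (invSqrt_nonneg n)]
  have h3 := sum_mul_norm_twistSum_mul_le (A := A) (t := t) (γ := γ) (X := Finset.Icc 1 ⌊K⌋₊)
    (Y := Finset.Icc 1 ⌊K⌋₊) (Z := Finset.Icc 1 ⌊K ^ 2⌋₊) (D := D) h1 h1 ?_ ?_ h2 h2 hD0 ?_
  · refine le_trans ?_ (mul_le_mul_of_nonneg_left h3 (by positivity))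
    unfold zetaEnergy crossEnergy
    simp_rw [← Finset.sum_product']
    have h4 : (∑ r ∈ A, γ r) ^ 2 = ∑ p ∈ A ×ˢ A, γ p.1 * γ p.2 := by
      rw [sq, Finset.sum_mul_sum, Finset.sum_product]
    rw [h4]
    -- Cauchy-Schwarz over pairs with weights γ_r γ_s, whose total mass is (∑ γ_r)².
    refine Finset.sum_sq_le_sum_mul_sum_of_sq_le_mul _ (fun p _ => mul_nonneg (hγ _) (hγ _))
      (fun p _ => mul_nonneg (mul_nonneg (hγ _) (hγ _)) (by positivity)) (fun p _ => le_of_eq ?_)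
    rw [norm_mul]
    ring
  · intro m hm n hn
    rw [Finset.mem_Icc] at hm hn ⊢
    refine ⟨Nat.mul_pos hm.1 hn.1, Nat.le_floor ?_⟩
    have hm' := (Nat.le_floor_iff hK).mp hm.2
    have hn' := (Nat.le_floor_iff hK).mp hn.2
    push_cast
    rw [sq]
    gcongr
  · intro n hn
    have := (Finset.mem_Icc.mp hn).1
    omega
  · intro n hn
    exact hD n ((Nat.le_floor_iff (by positivity)).mp (Finset.mem_Icc.mp hn).2)

/-- Signs can be chosen so that a signed sum has at least the total energy of its summands. -/
lemma exists_signs {κ : Type*} (P : Finset κ) (w : κ → ℝ) (f : ℕ → κ → ℂ) (Y : Finset ℕ) :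
    ∃ σ : ℕ → ℝ, (∀ m, |σ m| ≤ 1) ∧ ∑ m ∈ Y, ∑ p ∈ P, w p * ‖f m p‖ ^ 2 ≤
      ∑ p ∈ P, w p * ‖∑ m ∈ Y, (σ m : ℂ) * f m p‖ ^ 2 := by
  classical
  induction Y using Finset.induction_on with
  | empty => exact ⟨fun _ => 1, by simp, by simp⟩
  | insert a Y ha ih =>
    obtain ⟨σ, hσ, h⟩ := ih
    have hsum : ∀ x : ℝ, ∀ p, ∑ m ∈ insert a Y, ((Function.update σ a x m : ℝ) : ℂ) * f m p =
        (x : ℂ) * f a p + ∑ m ∈ Y, (σ m : ℂ) * f m p := by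
      intro x p
      rw [Finset.sum_insert ha, Function.update_self]
      congr 1
      refine Finset.sum_congr rfl fun m hm => ?_
      rw [Function.update_of_ne]
      rintro rfl
      exact ha hm
    have hbd : ∀ x : ℝ, |x| ≤ 1 → ∀ m, |Function.update σ a x m| ≤ 1 := by
      intro x hx m
      by_cases hm : m = a
      · subst hm; simpa using hx
      · rw [Function.update_of_ne hm]; exact hσ m
    -- By the parallelogram law the two choices of sign for the new term average to the sum of the
    -- two energies, so one choice is at least as large. The weights need no sign.
    have par : ∑ p ∈ P, w p * ‖((1 : ℝ) : ℂ) * f a p + ∑ m ∈ Y, (σ m : ℂ) * f m p‖ ^ 2 +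
        ∑ p ∈ P, w p * ‖((-1 : ℝ) : ℂ) * f a p + ∑ m ∈ Y, (σ m : ℂ) * f m p‖ ^ 2 =
        2 * (∑ p ∈ P, w p * ‖f a p‖ ^ 2 + ∑ p ∈ P, w p * ‖∑ m ∈ Y, (σ m : ℂ) * f m p‖ ^ 2) := by
      rw [← Finset.sum_add_distrib, ← Finset.sum_add_distrib, Finset.mul_sum]
      refine Finset.sum_congr rfl fun p _ => ?_
      have := parallelogram_law_with_norm ℝ (∑ m ∈ Y, (σ m : ℂ) * f m p) (f a p)
      rw [show ((1 : ℝ) : ℂ) * f a p + ∑ m ∈ Y, (σ m : ℂ) * f m p =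
        ∑ m ∈ Y, (σ m : ℂ) * f m p + f a p by push_cast; ring,
        show ((-1 : ℝ) : ℂ) * f a p + ∑ m ∈ Y, (σ m : ℂ) * f m p =
        ∑ m ∈ Y, (σ m : ℂ) * f m p - f a p by push_cast; ring]
      linear_combination w p * this
    rw [Finset.sum_insert ha]
    by_cases hc : ∑ p ∈ P, w p * ‖f a p‖ ^ 2 + ∑ p ∈ P, w p * ‖∑ m ∈ Y, (σ m : ℂ) * f m p‖ ^ 2 ≤
        ∑ p ∈ P, w p * ‖((1 : ℝ) : ℂ) * f a p + ∑ m ∈ Y, (σ m : ℂ) * f m p‖ ^ 2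
    · refine ⟨Function.update σ a 1, hbd 1 (by simp), ?_⟩
      simp_rw [hsum]
      linarith
    · refine ⟨Function.update σ a (-1), hbd (-1) (by simp), ?_⟩
      simp_rw [hsum]
      linarith

/-- The energy of a block is dominated by the energy of the block of products with another one. -/
lemma sum_inv_mul_crossEnergy_le {X Y Z : Finset ℕ} {D : ℝ}
    (hX : ∀ n ∈ X, n ≠ 0) (hY : ∀ n ∈ Y, n ≠ 0)
    (hZ : ∀ m ∈ X, ∀ n ∈ Y, m * n ∈ Z) (hZ0 : ∀ n ∈ Z, n ≠ 0)
    (hD0 : 0 ≤ D) (hD : ∀ n ∈ Z, (n.divisors.card : ℝ) ≤ D) :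
    (∑ m ∈ Y, (m : ℝ)⁻¹) * crossEnergy A A t γ X (fun n => (invSqrt n : ℂ)) ≤
      D ^ 2 * crossEnergy A A t γ Z (fun n => (invSqrt n : ℂ)) := by
  -- The signs give a lower bound by the sum over m of the separate energies, each being 1/m times
  -- the energy of X, while the signed coefficients are still bounded by n^{-1/2}.
  obtain ⟨σ, hσ, h⟩ := exists_signs (A ×ˢ A) (fun p => γ p.1 * γ p.2)
    (fun m p => twistSum X (fun n => (invSqrt n : ℂ)) (t p.1 - t p.2) * ((invSqrt m : ℂ) *
      Complex.exp (((t p.1 - t p.2) * Real.log m : ℝ) * Complex.I))) Y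
  have h2 := sum_mul_norm_twistSum_mul_le (A := A) (t := t) (γ := γ)
    (a := fun n => (invSqrt n : ℂ)) (b := fun n => (σ n * invSqrt n : ℂ)) hX hY hZ hZ0
    (fun n _ => by rw [Complex.norm_real, Real.norm_of_nonneg (invSqrt_nonneg n)])
    (fun n _ => by
      rw [← Complex.ofReal_mul, Complex.norm_real, Real.norm_eq_abs, abs_mul,
        abs_of_nonneg (invSqrt_nonneg n)]
      exact mul_le_of_le_one_left (invSqrt_nonneg n) (hσ n)) hD0 hD
  refine le_trans (le_of_eq ?_) (h.trans (le_trans (le_of_eq ?_) h2))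
  · rw [Finset.sum_mul]
    refine Finset.sum_congr rfl fun m _ => ?_
    unfold crossEnergy
    rw [Finset.sum_product, Finset.mul_sum]
    refine Finset.sum_congr rfl fun r _ => ?_
    rw [Finset.mul_sum]
    refine Finset.sum_congr rfl fun s _ => ?_
    rw [norm_mul, norm_mul, Complex.norm_exp_ofReal_mul_I, Complex.norm_real,
      Real.norm_of_nonneg (invSqrt_nonneg m), mul_one, mul_pow]
    have : invSqrt m ^ 2 = (m : ℝ)⁻¹ := by
      unfold invSqrt
      rw [inv_pow, Real.sq_sqrt (by positivity)]
    rw [this]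
    ring
  · rw [Finset.sum_product]
    refine Finset.sum_congr rfl fun r _ => Finset.sum_congr rfl fun s _ => ?_
    congr 3
    conv_rhs => rw [twistSum.eq_def Y, Finset.mul_sum]
    refine Finset.sum_congr rfl fun m _ => ?_
    ring

end Products

/-! ### Reduction of a partial sum to one block -/

section Blocks

/-- Cauchy-Schwarz over the L dyadic blocks. -/
lemma crossEnergy_Ico_two_pow_le {ι : Type*} {A : Finset ι} {t γ : ι → ℝ} (hγ : ∀ r, 0 ≤ γ r)
    (c : ℕ → ℂ) (L : ℕ) :
    crossEnergy A A t γ (Finset.Ico 1 (2 ^ L)) c ≤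
      L * ∑ i ∈ Finset.range L, crossEnergy A A t γ (Finset.Ico (2 ^ i) (2 ^ (i + 1))) c := by
  have h1 : ∀ τ, twistSum (Finset.Ico 1 (2 ^ L)) c τ =
      ∑ i ∈ Finset.range L, twistSum (Finset.Ico (2 ^ i) (2 ^ (i + 1))) c τ := by
    intro τ
    unfold twistSum
    induction L with
    | zero => simp
    | succ L ih =>
      rw [Finset.sum_range_succ, ← ih, Finset.sum_Ico_consecutive]
      · exact Nat.one_le_two_pow
      · exact Nat.pow_le_pow_right (by norm_num) (by omega)
  unfold crossEnergy
  have h2 : (L : ℝ) * ∑ i ∈ Finset.range L, ∑ r ∈ A, ∑ s ∈ A, γ r * γ s *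
      ‖twistSum (Finset.Ico (2 ^ i) (2 ^ (i + 1))) c (t r - t s)‖ ^ 2 =
      ∑ r ∈ A, ∑ s ∈ A, γ r * γ s * (L * ∑ i ∈ Finset.range L,
      ‖twistSum (Finset.Ico (2 ^ i) (2 ^ (i + 1))) c (t r - t s)‖ ^ 2) := by
    rw [Finset.sum_comm, Finset.mul_sum]
    refine Finset.sum_congr rfl fun r _ => ?_
    rw [Finset.sum_comm, Finset.mul_sum]
    refine Finset.sum_congr rfl fun s _ => ?_
    rw [← Finset.mul_sum]
    ring
  rw [h2]
  refine Finset.sum_le_sum fun r _ => Finset.sum_le_sum fun s _ => ?_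
  refine mul_le_mul_of_nonneg_left ?_ (mul_nonneg (hγ r) (hγ s))
  rw [h1]
  calc _ ≤ (∑ i ∈ Finset.range L,
      ‖twistSum (Finset.Ico (2 ^ i) (2 ^ (i + 1))) c (t r - t s)‖) ^ 2 := by
        gcongr; exact norm_sum_le _ _
    _ ≤ _ := by
        have := sq_sum_le_card_mul_sum_sq (s := Finset.range L)
          (f := fun i => ‖twistSum (Finset.Ico (2 ^ i) (2 ^ (i + 1))) c (t r - t s)‖)
        rwa [Finset.card_range] at this

lemma half_le_sum_inv (p : ℕ) :
    (1 / 2 : ℝ) ≤ ∑ m ∈ Finset.Ico ((2 : ℕ) ^ p) (2 ^ (p + 1)), (m : ℝ)⁻¹ := by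
  have h : ∀ m ∈ Finset.Ico ((2 : ℕ) ^ p) (2 ^ (p + 1)), ((2 : ℝ) ^ (p + 1))⁻¹ ≤ (m : ℝ)⁻¹ := by
    intro m hm
    rw [Finset.mem_Ico] at hm
    have h0 : 0 < m := lt_of_lt_of_le (by positivity) hm.1
    have h0' : (0 : ℝ) < m := by exact_mod_cast h0
    gcongr
    exact_mod_cast hm.2.le
  have h2 := Finset.card_nsmul_le_sum _ _ _ h
  refine le_trans (le_of_eq ?_) h2
  rw [Nat.card_Ico, nsmul_eq_mul, show 2 ^ (p + 1) - 2 ^ p = 2 ^ p by rw [pow_succ]; omega]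
  push_cast
  rw [pow_succ]
  field_simp

/-- A partial sum of the zeta function is controlled by a single block at the end of its range. -/
lemma exists_zetaEnergy_le_block {ε : ℝ} (hε : 0 < ε) :
    ∃ C : ℝ, 1 ≤ C ∧ ∀ {ι : Type} (A : Finset ι) (t γ : ι → ℝ), (∀ r, 0 ≤ γ r) →
      ∀ M : ℝ, 1 ≤ M → ∃ P : ℕ, (P : ℝ) ≤ M ∧ M < 2 * P ∧
        zetaEnergy A t γ M ≤ C * M ^ ε *
          crossEnergy A A t γ (Finset.Icc P (4 * P)) (fun n => (invSqrt n : ℂ)) := by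
  obtain ⟨Cd, hCd, hd⟩ := exists_card_divisors_le_rpow (ε := ε / 4) (by positivity)
  obtain ⟨Cl, hCl, hl⟩ : ∃ Cl : ℝ, 1 ≤ Cl ∧ ∀ l : ℕ, (l + 1 : ℝ) ≤ Cl * ((2 : ℝ) ^ l) ^ (ε / 4) :=
    ⟨_, by
      have : 0 < ε / 4 * Real.log 2 := mul_pos (by positivity) (Real.log_pos (by norm_num))
      have : 0 < 1 / (ε / 4 * Real.log 2) := by positivity
      linarith, natCast_add_one_le_mul_two_pow_rpow (ε := ε / 4) (by positivity)⟩
  set D₀ : ℝ := Cd * 4 ^ (ε / 4) with hD₀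
  have hD₀1 : 1 ≤ D₀ := one_le_mul_of_one_le_of_one_le hCd
    (Real.one_le_rpow (by norm_num) (by positivity))
  refine ⟨Cl ^ 2 * (2 * D₀ ^ 2), ?_, ?_⟩
  · have h1 : 1 ≤ Cl ^ 2 := one_le_pow₀ hCl
    have h2 : 1 ≤ D₀ ^ 2 := one_le_pow₀ hD₀1
    nlinarith
  intro ι A t γ hγ M hM
  obtain ⟨l, hl1, hl2⟩ := exists_nat_pow_near hM (by norm_num : (1 : ℝ) < 2)
  have hM0 : 0 < M := by linarith
  refine ⟨2 ^ l, by exact_mod_cast hl1, by rw [pow_succ] at hl2; push_cast; linarith, ?_⟩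
  set E := crossEnergy A A t γ (Finset.Icc (2 ^ l) (4 * 2 ^ l)) (fun n => (invSqrt n : ℂ)) with hE
  have hE0 : 0 ≤ E := crossEnergy_nonneg hγ _ _
  set D : ℝ := D₀ * M ^ (ε / 4) with hD
  have hblock : ∀ i ∈ Finset.range (l + 1), crossEnergy A A t γ
      (Finset.Ico (2 ^ i) (2 ^ (i + 1))) (fun n => (invSqrt n : ℂ)) ≤ 2 * (D ^ 2 * E) := by
    intro i hi
    have hil : i ≤ l := by rw [Finset.mem_range] at hi; omega
    have hne : ∀ p : ℕ, ∀ n ∈ Finset.Ico (2 ^ p) (2 ^ (p + 1)), n ≠ 0 := by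
      intro p n hn
      have := (Finset.mem_Ico.mp hn).1
      have : 0 < 2 ^ p := by positivity
      omega
    -- The partner block at 2^(l-i) makes every product land in [2^l, 4·2^l], whatever i is; its
    -- harmonic sum is at least 1/2.
    have h1 := sum_inv_mul_crossEnergy_le (A := A) (t := t) (γ := γ)
      (X := Finset.Ico (2 ^ i) (2 ^ (i + 1))) (Y := Finset.Ico (2 ^ (l - i)) (2 ^ (l - i + 1)))
      (Z := Finset.Icc (2 ^ l) (4 * 2 ^ l)) (D := D) (hne _) (hne _) ?_ ?_ (by positivity) ?_
    · have h2 := half_le_sum_inv (l - i)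
      have h3 := crossEnergy_nonneg (A := A) (B := A) (t := t) hγ
        (Finset.Ico (2 ^ i) (2 ^ (i + 1))) (fun n => (invSqrt n : ℂ))
      nlinarith
    · intro m hm n hn
      rw [Finset.mem_Ico] at hm hn
      have e1 : 2 ^ l = 2 ^ i * 2 ^ (l - i) := by rw [← pow_add]; congr 1; omega
      have e2 : 4 * 2 ^ l = 2 ^ (i + 1) * 2 ^ (l - i + 1) := by rw [e1]; ring
      rw [Finset.mem_Icc, e2, e1]
      exact ⟨Nat.mul_le_mul hm.1 hn.1, Nat.mul_le_mul hm.2.le hn.2.le⟩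
    · intro n hn
      have := (Finset.mem_Icc.mp hn).1
      have : 0 < 2 ^ l := by positivity
      omega
    · intro n hn
      refine (hd n).trans ?_
      have h4 : (n : ℝ) ≤ 4 * M := by
        have : (n : ℝ) ≤ 4 * 2 ^ l := by exact_mod_cast (Finset.mem_Icc.mp hn).2
        linarith
      calc Cd * (n : ℝ) ^ (ε / 4) ≤ Cd * (4 * M) ^ (ε / 4) := by gcongr
        _ = D := by rw [Real.mul_rpow (by norm_num) hM0.le, hD, hD₀]; ring
  have hsub : Finset.Icc 1 ⌊M⌋₊ ⊆ Finset.Ico 1 (2 ^ (l + 1)) := by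
    intro n hn
    rw [Finset.mem_Icc] at hn
    rw [Finset.mem_Ico]
    refine ⟨hn.1, ?_⟩
    have := (Nat.le_floor_iff hM0.le).mp hn.2
    have h5 : (n : ℝ) < 2 ^ (l + 1) := by linarith
    exact_mod_cast h5
  calc zetaEnergy A t γ M ≤ crossEnergy A A t γ (Finset.Ico 1 (2 ^ (l + 1)))
        (fun n => (invSqrt n : ℂ)) := crossEnergy_mono hsub
          (fun n _ => by rw [Complex.norm_real, Real.norm_of_nonneg (invSqrt_nonneg n)])
          invSqrt_nonneg
    _ ≤ _ := crossEnergy_Ico_two_pow_le hγ _ _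
    _ ≤ ((l + 1 : ℕ) : ℝ) * ∑ i ∈ Finset.range (l + 1), 2 * (D ^ 2 * E) := by
        gcongr with i hi
        exact hblock i hi
    -- One factor l + 1 comes from Cauchy-Schwarz and one from the number of blocks; each is
    -- absorbed by a multiple of M^(ε/4).
    _ = (l + 1 : ℝ) ^ 2 * (2 * (D ^ 2 * E)) := by
        rw [Finset.sum_const, Finset.card_range, nsmul_eq_mul]; push_cast; ring
    _ ≤ (Cl * M ^ (ε / 4)) ^ 2 * (2 * (D ^ 2 * E)) := by
        gcongr
        refine (hl l).trans ?_
        gcongr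
    _ = Cl ^ 2 * (2 * D₀ ^ 2) * M ^ ε * E := by
        have : M ^ ε = (M ^ (ε / 4)) ^ 4 := by
          rw [← Real.rpow_natCast, ← Real.rpow_mul hM0.le]; congr 1; push_cast; ring
        rw [this, hD]; ring

end Blocks

/-! ### The mean value theorem with a Gaussian weight -/

section MeanValue

/-- The integers ⌊t_s - x⌋ are distinct by spacing, so the sum is dominated by a convergent series
over ℤ. -/
lemma exists_sum_exp_le : ∃ C : ℝ, 0 < C ∧ ∀ {ι : Type} (A : Finset ι) (t : ι → ℝ),
    (∀ r ∈ A, ∀ s ∈ A, r ≠ s → 1 ≤ |t r - t s|) → ∀ x : ℝ,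
      ∑ s ∈ A, Real.exp (-(x - t s) ^ 2 / 4) ≤ C := by
  have hsum : Summable fun z : ℤ => 16 / ((|z| : ℝ) + 1) ^ 2 := by
    have h := ((Real.summable_one_div_int_add_rpow (1 / 2) 2).mpr (by norm_num)).mul_left 16
    refine h.of_nonneg_of_le (fun z => by positivity) fun z => ?_
    have h1 : (z : ℝ) + 1 / 2 ≠ 0 := by
      intro h0
      have h2 : (2 * z + 1 : ℝ) = 0 := by linarith
      have h3 : 2 * z + 1 = 0 := by exact_mod_cast h2
      omega
    have h2 := abs_pos.mpr h1
    have h3 : |(z : ℝ) + 1 / 2| ≤ |(z : ℝ)| + 1 := (abs_add_le _ _).trans (by norm_num)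
    rw [Real.rpow_two, mul_one_div]
    gcongr
  refine ⟨∑' z : ℤ, 16 / ((|z| : ℝ) + 1) ^ 2 + 1, ?_, ?_⟩
  · have : 0 ≤ ∑' z : ℤ, 16 / ((|z| : ℝ) + 1) ^ 2 := tsum_nonneg fun z => by positivity
    linarith
  intro ι A t ht x
  have hinj : Set.InjOn (fun s => ⌊t s - x⌋) (A : Set ι) := by
    intro r hr s hs hrs
    by_contra hne
    have h1 := ht r hr s hs hne
    have h2 := Int.abs_sub_lt_one_of_floor_eq_floor hrs
    rw [sub_sub_sub_cancel_right] at h2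
    linarith
  have hle : ∀ y : ℝ, Real.exp (-y ^ 2 / 4) ≤ 16 / ((|⌊y⌋| : ℝ) + 1) ^ 2 := by
    intro y
    have h1 : (|⌊y⌋| : ℝ) ≤ |y| + 1 := by
      rw [abs_le]
      have := Int.floor_le y
      have := Int.lt_floor_add_one y
      constructor
      · have := neg_abs_le y; linarith
      · have := le_abs_self y; linarith
    have h2 : ((|⌊y⌋| : ℝ) + 1) ^ 2 ≤ (|y| + 2) ^ 2 := by
      exact pow_le_pow_left₀ (by positivity) (by linarith) 2
    rw [le_div_iff₀ (by positivity)]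
    have h3 := Real.add_one_le_exp (y ^ 2 / 4)
    have h4 : Real.exp (-y ^ 2 / 4) * Real.exp (y ^ 2 / 4) = 1 := by
      rw [← Real.exp_add]; simp [neg_div]
    have h5 : ((|⌊y⌋| : ℝ) + 1) ^ 2 ≤ 16 * Real.exp (y ^ 2 / 4) := by
      nlinarith [sq_abs y, sq_nonneg (|y| - 2)]
    calc _ ≤ Real.exp (-y ^ 2 / 4) * (16 * Real.exp (y ^ 2 / 4)) := by gcongr
      _ = 16 := by linear_combination 16 * h4
  calc ∑ s ∈ A, Real.exp (-(x - t s) ^ 2 / 4)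
      ≤ ∑ s ∈ A, 16 / ((|⌊t s - x⌋| : ℝ) + 1) ^ 2 := by
        refine Finset.sum_le_sum fun s _ => ?_
        rw [show (x - t s) ^ 2 = (t s - x) ^ 2 by ring]
        exact hle _
    _ = ∑ z ∈ A.image (fun s => ⌊t s - x⌋), 16 / ((|z| : ℝ) + 1) ^ 2 := by
        rw [Finset.sum_image hinj]
    _ ≤ ∑' z : ℤ, 16 / ((|z| : ℝ) + 1) ^ 2 := hsum.sum_le_tsum _ fun z _ => by positivity
    _ ≤ _ := by linarith

lemma integrable_exp_mul_gaussian (τ : ℝ) : MeasureTheory.Integrable (fun u : ℝ =>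
    Complex.exp ((u * τ : ℝ) * Complex.I) * ((Real.exp (-u ^ 2) : ℝ) : ℂ)) := by
  have := (integrable_exp_neg_mul_sq (b := 1) (by norm_num)).ofReal (𝕜 := ℂ)
  refine (this.bdd_mul (c := 1) (f := fun u : ℝ => Complex.exp ((u * τ : ℝ) * Complex.I))
    ?_ ?_).congr ?_
  · exact (by fun_prop : Continuous _).aestronglyMeasurable
  · filter_upwards with u
    rw [Complex.norm_exp_ofReal_mul_I]
  · filter_upwards with u
    simp

lemma integral_exp_mul_gaussian (τ : ℝ) : ∫ u : ℝ,
    Complex.exp ((u * τ : ℝ) * Complex.I) * ((Real.exp (-u ^ 2) : ℝ) : ℂ) =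
      ((Real.sqrt Real.pi * Real.exp (-τ ^ 2 / 4) : ℝ) : ℂ) := by
  have h := fourierIntegral_gaussian (b := 1) (by norm_num) (τ : ℂ)
  rw [div_one, mul_one] at h
  have h2 : ((Real.pi : ℂ) ^ (1 / 2 : ℂ)) = ((Real.sqrt Real.pi : ℝ) : ℂ) := by
    rw [Real.sqrt_eq_rpow, Complex.ofReal_cpow Real.pi_pos.le]
    norm_num
  rw [h2] at h
  push_cast
  rw [show (-(τ : ℂ) ^ 2 / 4) = -(τ : ℂ) ^ 2 / 4 by ring, ← h]
  congr 1
  ext u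
  congr 2
  · ring
  · ring

/-- The mean value theorem for generalized Dirichlet polynomials with well spaced frequencies. -/
lemma exists_integral_norm_weightSum_sq_le : ∃ C : ℝ, 0 < C ∧ ∀ {ι : Type} (A : Finset ι)
    (t γ : ι → ℝ), (∀ r, 0 ≤ γ r) → (∀ r ∈ A, ∀ s ∈ A, r ≠ s → 1 ≤ |t r - t s|) →
      ∫ u in Set.Icc (-3 : ℝ) 3, ‖weightSum A t γ u‖ ^ 2 ≤ C * ∑ r ∈ A, γ r ^ 2 := by
  obtain ⟨C₁, hC₁, h₁⟩ := exists_sum_exp_le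
  refine ⟨Real.exp 9 * (Real.sqrt Real.pi * C₁), by positivity, ?_⟩
  intro ι A t γ hγ ht
  have hexp : ∀ u, (((‖weightSum A t γ u‖ ^ 2 * Real.exp (-u ^ 2) : ℝ)) : ℂ) =
      ∑ r ∈ A, ∑ s ∈ A, (γ r * γ s : ℂ) * (Complex.exp ((u * (t r - t s) : ℝ) * Complex.I) *
        ((Real.exp (-u ^ 2) : ℝ) : ℂ)) := by
    intro u
    rw [Complex.ofReal_mul, Complex.ofReal_pow, ← Complex.mul_conj', weightSum_mul_conj,
      Finset.sum_mul]
    refine Finset.sum_congr rfl fun r _ => ?_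
    rw [Finset.sum_mul]
    exact Finset.sum_congr rfl fun s _ => mul_assoc _ _ _
  have hintC : MeasureTheory.Integrable fun u =>
      (((‖weightSum A t γ u‖ ^ 2 * Real.exp (-u ^ 2) : ℝ)) : ℂ) := by
    simp_rw [hexp]
    exact MeasureTheory.integrable_finsetSum _ fun r _ => MeasureTheory.integrable_finsetSum _
      fun s _ => (integrable_exp_mul_gaussian _).const_mul _
  have hint : MeasureTheory.Integrable fun u => ‖weightSum A t γ u‖ ^ 2 * Real.exp (-u ^ 2) := by
    have := hintC.re
    simp only [RCLike.re_to_complex, Complex.ofReal_re] at this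
    exact this
  have hval : ∫ u, ‖weightSum A t γ u‖ ^ 2 * Real.exp (-u ^ 2) =
      ∑ r ∈ A, ∑ s ∈ A, γ r * γ s * (Real.sqrt Real.pi * Real.exp (-(t r - t s) ^ 2 / 4)) := by
    have : ((∫ u, ‖weightSum A t γ u‖ ^ 2 * Real.exp (-u ^ 2) : ℝ) : ℂ) =
        ((∑ r ∈ A, ∑ s ∈ A, γ r * γ s *
          (Real.sqrt Real.pi * Real.exp (-(t r - t s) ^ 2 / 4)) : ℝ) : ℂ) := by
      rw [← integral_complex_ofReal]
      simp_rw [hexp]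
      rw [MeasureTheory.integral_finsetSum]
      · rw [Complex.ofReal_sum]
        refine Finset.sum_congr rfl fun r _ => ?_
        rw [MeasureTheory.integral_finsetSum, Complex.ofReal_sum]
        · refine Finset.sum_congr rfl fun s _ => ?_
          rw [MeasureTheory.integral_const_mul, integral_exp_mul_gaussian]
          push_cast
          ring
        · exact fun s _ => (integrable_exp_mul_gaussian _).const_mul _
      · exact fun r _ => MeasureTheory.integrable_finsetSum _
          fun s _ => (integrable_exp_mul_gaussian _).const_mul _
    exact_mod_cast this
  have hcont : Continuous fun u => ‖weightSum A t γ u‖ ^ 2 := by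
    unfold weightSum; fun_prop
  calc ∫ u in Set.Icc (-3 : ℝ) 3, ‖weightSum A t γ u‖ ^ 2
      ≤ ∫ u in Set.Icc (-3 : ℝ) 3, Real.exp 9 * (‖weightSum A t γ u‖ ^ 2 * Real.exp (-u ^ 2)) := by
        refine MeasureTheory.setIntegral_mono_on hcont.continuousOn.integrableOn_Icc
          (hint.const_mul _).integrableOn measurableSet_Icc fun u hu => ?_
        have h2 : 1 ≤ Real.exp 9 * Real.exp (-u ^ 2) := by
          rw [← Real.exp_add]
          refine Real.one_le_exp ?_
          nlinarith [hu.1, hu.2]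
        nlinarith [sq_nonneg ‖weightSum A t γ u‖]
    _ ≤ ∫ u, Real.exp 9 * (‖weightSum A t γ u‖ ^ 2 * Real.exp (-u ^ 2)) :=
        MeasureTheory.setIntegral_le_integral (hint.const_mul _)
          (Filter.Eventually.of_forall fun u => by positivity)
    _ = Real.exp 9 * ∑ r ∈ A, ∑ s ∈ A,
          γ r * γ s * (Real.sqrt Real.pi * Real.exp (-(t r - t s) ^ 2 / 4)) := by
        rw [MeasureTheory.integral_const_mul, hval]
    _ ≤ Real.exp 9 * (Real.sqrt Real.pi * C₁ * ∑ r ∈ A, γ r ^ 2) := by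
        gcongr
        -- Using 2γ_rγ_s ≤ γ_r² + γ_s² leaves only row sums of the Gaussian kernel, bounded by
        -- `exists_sum_exp_le`.
        calc _ ≤ ∑ r ∈ A, ∑ s ∈ A, (Real.sqrt Real.pi / 2) *
              (γ r ^ 2 * Real.exp (-(t r - t s) ^ 2 / 4) +
              γ s ^ 2 * Real.exp (-(t s - t r) ^ 2 / 4)) := by
              refine Finset.sum_le_sum fun r _ => Finset.sum_le_sum fun s _ => ?_
              rw [show (t s - t r) ^ 2 = (t r - t s) ^ 2 by ring]
              have : 0 ≤ Real.sqrt Real.pi * Real.exp (-(t r - t s) ^ 2 / 4) := by positivity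
              nlinarith [mul_nonneg this (sq_nonneg (γ r - γ s))]
          _ = Real.sqrt Real.pi * ∑ r ∈ A, γ r ^ 2 *
              ∑ s ∈ A, Real.exp (-(t r - t s) ^ 2 / 4) := by
              simp_rw [← Finset.mul_sum, Finset.sum_add_distrib]
              rw [Finset.sum_comm (f := fun r s => γ s ^ 2 * Real.exp (-(t s - t r) ^ 2 / 4))]
              simp_rw [← Finset.mul_sum]
              ring
          _ ≤ Real.sqrt Real.pi * ∑ r ∈ A, γ r ^ 2 * C₁ := by
              gcongr with r hr
              exact h₁ A t ht (t r)
          _ = _ := by rw [← Finset.sum_mul]; ring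
    _ = _ := by ring

end MeanValue

/-! ### Lattice points in thin parallelograms -/

section Lattice

lemma card_le_of_sub_le {S : Finset ℤ} {D : ℝ} (hD : 0 ≤ D)
    (h : ∀ a ∈ S, ∀ b ∈ S, ((b - a : ℤ) : ℝ) ≤ D) : (S.card : ℝ) ≤ D + 1 := by
  rcases S.eq_empty_or_nonempty with rfl | hS
  · simp only [Finset.card_empty, Nat.cast_zero]; positivity
  have h1 : S ⊆ Finset.Icc (S.min' hS) (S.max' hS) := fun x hx =>
    Finset.mem_Icc.mpr ⟨S.min'_le x hx, S.le_max' x hx⟩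
  have h2 := Finset.card_le_card h1
  rw [Int.card_Icc] at h2
  have h3 := h _ (S.min'_mem hS) _ (S.max'_mem hS)
  have h4 : S.min' hS ≤ S.max' hS := S.min'_le _ (S.max'_mem hS)
  have h5 : (S.card : ℤ) ≤ S.max' hS - S.min' hS + 1 := by omega
  have h6 : (S.card : ℝ) ≤ ((S.max' hS - S.min' hS : ℤ) : ℝ) + 1 := by exact_mod_cast h5
  linarith

lemma exists_sub_eq_card {S : Finset ℤ} (hS : S.Nonempty) :
    ∃ a ∈ S, ∃ b ∈ S, (S.card : ℤ) ≤ b - a + 1 := by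
  refine ⟨S.min' hS, S.min'_mem hS, S.max' hS, S.max'_mem hS, ?_⟩
  have h1 : S ⊆ Finset.Icc (S.min' hS) (S.max' hS) := fun x hx =>
    Finset.mem_Icc.mpr ⟨S.min'_le x hx, S.le_max' x hx⟩
  have h2 := Finset.card_le_card h1
  rw [Int.card_Icc] at h2
  have h4 : S.min' hS ≤ S.max' hS := S.min'_le _ (S.max'_mem hS)
  omega

/-- Lattice points in a parallelogram, counted along the lines of direction `(j, k)`. -/
lemma card_le_along_direction {P : Finset (ℤ × ℤ)} (hP : P.Nonempty) {y δ L : ℝ}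
    (hδ : 0 ≤ δ) (hL : 0 ≤ L)
    (h1 : ∀ p ∈ P, |(p.1 : ℝ) - p.2 * y| ≤ δ)
    (h2 : ∀ p ∈ P, ∀ q ∈ P, |(p.2 : ℝ) - q.2| ≤ L) {j k : ℤ} (hk : 0 < k) (hjk : IsCoprime j k) :
    ∃ r : ℕ, r * (k : ℝ) ≤ L ∧ r * |(j : ℝ) - k * y| ≤ 2 * δ ∧
      (P.card : ℝ) ≤ (2 * k * δ + L * |(j : ℝ) - k * y| + 1) * (r + 1) := by
  classical
  set e : ℝ := (j : ℝ) - k * y with he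
  have hk0 : (0 : ℝ) < k := by exact_mod_cast hk
  set lev : ℤ × ℤ → ℤ := fun p => k * p.1 - j * p.2 with hlev
  have hlevels : ((P.image lev).card : ℝ) ≤ 2 * k * δ + L * |e| + 1 := by
    refine card_le_of_sub_le (by positivity) ?_
    intro a ha b hb
    obtain ⟨p, hp, rfl⟩ := Finset.mem_image.mp ha
    obtain ⟨q, hq, rfl⟩ := Finset.mem_image.mp hb
    have e1 : ((lev q - lev p : ℤ) : ℝ) = k * ((q.1 - q.2 * y) - (p.1 - p.2 * y)) +
        (p.2 - q.2) * e := by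
      rw [hlev, he]; push_cast; ring
    rw [e1]
    have a1 := abs_le.mp (h1 p hp)
    have a2 := abs_le.mp (h1 q hq)
    have a3 : ((p.2 : ℝ) - q.2) * e ≤ L * |e| := by
      refine (le_abs_self _).trans ?_
      rw [abs_mul]
      gcongr
      exact h2 p hp q hq
    have a4 : (k : ℝ) * ((q.1 - q.2 * y) - (p.1 - p.2 * y)) ≤ k * (2 * δ) := by
      gcongr
      linarith [a1.1, a2.2]
    linarith
  -- The fullest of the parallel lines; the count is at most its size times the number of lines.
  obtain ⟨c, hc, hmax⟩ := Finset.exists_max_image (P.image lev)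
    (fun c => (P.filter (fun p => lev p = c)).card) (hP.image lev)
  set Fb := P.filter (fun p => lev p = c) with hFb
  have hFbne : Fb.Nonempty := by
    obtain ⟨p, hp, hpc⟩ := Finset.mem_image.mp hc
    exact ⟨p, Finset.mem_filter.mpr ⟨hp, hpc⟩⟩
  obtain ⟨p₀, hp₀⟩ := hFbne
  have hpar : ∀ p ∈ Fb, ∃ q : ℤ, p.1 = p₀.1 + q * j ∧ p.2 = p₀.2 + q * k := by
    intro p hp
    have l1 : k * p.1 - j * p.2 = c := (Finset.mem_filter.mp hp).2
    have l2 : k * p₀.1 - j * p₀.2 = c := (Finset.mem_filter.mp hp₀).2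
    have l3 : k * (p.1 - p₀.1) = j * (p.2 - p₀.2) := by linarith
    have l4 : k ∣ p.2 - p₀.2 := hjk.symm.dvd_of_dvd_mul_left ⟨_, l3.symm⟩
    obtain ⟨q, hq⟩ := l4
    refine ⟨q, ?_, by linarith⟩
    rw [hq] at l3
    have : p.1 - p₀.1 = j * q := by
      have : k * (p.1 - p₀.1) = k * (j * q) := by rw [l3]; ring
      exact mul_left_cancel₀ hk.ne' this
    linarith
  choose! qf hq1 hq2 using hpar
  have hinj : Set.InjOn qf (Fb : Set (ℤ × ℤ)) := by
    intro a ha b hb hab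
    exact Prod.ext (by rw [hq1 a ha, hq1 b hb, hab]) (by rw [hq2 a ha, hq2 b hb, hab])
  -- The extreme points of this line differ by at least r = `Fb.card - 1` steps (j, k), so r steps
  -- still fit in the parallelogram.
  obtain ⟨a, ha, b, hb, hcard⟩ := exists_sub_eq_card (S := Fb.image qf) ⟨_, Finset.mem_image_of_mem _ hp₀⟩
  rw [Finset.card_image_of_injOn hinj] at hcard
  obtain ⟨pa, hpa, rfl⟩ := Finset.mem_image.mp ha
  obtain ⟨pb, hpb, rfl⟩ := Finset.mem_image.mp hb
  have hpaP := (Finset.mem_filter.mp hpa).1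
  have hpbP := (Finset.mem_filter.mp hpb).1
  have hcpos : 0 < Fb.card := Finset.card_pos.mpr ⟨p₀, hp₀⟩
  have hqz : ((Fb.card - 1 : ℕ) : ℤ) ≤ qf pb - qf pa := by omega
  have hqr : ((Fb.card - 1 : ℕ) : ℝ) ≤ (qf pb : ℝ) - qf pa := by exact_mod_cast hqz
  have hq0 : (0 : ℝ) ≤ (qf pb : ℝ) - qf pa := le_trans (Nat.cast_nonneg _) hqr
  refine ⟨Fb.card - 1, ?_, ?_, ?_⟩
  · calc ((Fb.card - 1 : ℕ) : ℝ) * k ≤ ((qf pb : ℝ) - qf pa) * k := by gcongr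
      _ = (pb.2 : ℝ) - pa.2 := by rw [hq2 pb hpb, hq2 pa hpa]; push_cast; ring
      _ ≤ L := (le_abs_self _).trans (h2 pb hpbP pa hpaP)
  · calc ((Fb.card - 1 : ℕ) : ℝ) * |e| ≤ ((qf pb : ℝ) - qf pa) * |e| := by gcongr
      _ = |((qf pb : ℝ) - qf pa) * e| := by rw [abs_mul, abs_of_nonneg hq0]
      _ = |((pb.1 : ℝ) - pb.2 * y) - (pa.1 - pa.2 * y)| := by
          rw [hq1 pb hpb, hq1 pa hpa, hq2 pb hpb, hq2 pa hpa, he]; push_cast; congr 1; ring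
      _ ≤ |(pb.1 : ℝ) - pb.2 * y| + |(pa.1 : ℝ) - pa.2 * y| := abs_sub _ _
      _ ≤ 2 * δ := by linarith [h1 pb hpbP, h1 pa hpaP]
  · have := Finset.card_le_mul_card_image P Fb.card (fun c' hc' => hmax c' hc')
    have h3 : (P.card : ℝ) ≤ Fb.card * (P.image lev).card := by exact_mod_cast this
    have h4 : ((Fb.card - 1 : ℕ) : ℝ) + 1 = Fb.card := by
      rw [Nat.cast_sub hcpos]; push_cast; ring
    rw [h4]
    calc (P.card : ℝ) ≤ Fb.card * (P.image lev).card := h3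
      _ ≤ Fb.card * (2 * k * δ + L * |e| + 1) := by gcongr
      _ = _ := by ring

/-- A thin parallelogram with many lattice points contains a long arithmetic progression. -/
lemma exists_direction_card_le {P : Finset (ℤ × ℤ)} (hP : 1 < P.card) {y δ L : ℝ}
    (hδ : 0 ≤ δ) (hδ2 : δ < 1 / 2) (hL : 0 ≤ L)
    (h1 : ∀ p ∈ P, |(p.1 : ℝ) - p.2 * y| ≤ δ)
    (h2 : ∀ p ∈ P, ∀ q ∈ P, |(p.2 : ℝ) - q.2| ≤ L) :
    ∃ j k : ℤ, 0 < k ∧ ∃ r : ℕ, r * (k : ℝ) ≤ L ∧ r * |(j : ℝ) - k * y| ≤ 2 * δ ∧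
      (P.card : ℝ) ≤ 1 + 8 * δ * L + r := by
  -- On one horizontal line the width is 2δ < 1, so two distinct points have different heights.
  -- Their difference divided by its gcd is the direction.
  obtain ⟨p, hp, q, hq, hlt⟩ : ∃ p ∈ P, ∃ q ∈ P, p.2 < q.2 := by
    obtain ⟨p, hp, q, hq, hne⟩ := Finset.one_lt_card.mp hP
    rcases lt_trichotomy p.2 q.2 with h | h | h
    · exact ⟨p, hp, q, hq, h⟩
    · exfalso
      apply hne
      refine Prod.ext ?_ h
      have a1 := abs_le.mp (h1 p hp)
      have a2 := abs_le.mp (h1 q hq)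
      rw [h] at a1
      have a3 : ((p.1 - q.1 : ℤ) : ℝ) < 1 := by push_cast; linarith [a1.2, a2.1]
      have a4 : ((q.1 - p.1 : ℤ) : ℝ) < 1 := by push_cast; linarith [a1.1, a2.2]
      have a3' : p.1 - q.1 < 1 := by exact_mod_cast a3
      have a4' : q.1 - p.1 < 1 := by exact_mod_cast a4
      omega
    · exact ⟨q, hq, p, hp, h⟩
  set J := q.1 - p.1 with hJ
  set K := q.2 - p.2 with hK
  have hKpos : 0 < K := by omega
  have hg : 0 < Int.gcd J K := Int.gcd_pos_of_ne_zero_right _ hKpos.ne'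
  obtain ⟨j, hj⟩ := Int.gcd_dvd_left J K
  obtain ⟨k, hk⟩ := Int.gcd_dvd_right J K
  have hcop : IsCoprime j k := by
    rw [Int.isCoprime_iff_gcd_eq_one]
    have h3 := Int.gcd_div_gcd_div_gcd hg
    have hg' : ((Int.gcd J K : ℕ) : ℤ) ≠ 0 := by exact_mod_cast hg.ne'
    rwa [show J / (Int.gcd J K : ℤ) = j from Int.ediv_eq_of_eq_mul_right hg' hj,
      show K / (Int.gcd J K : ℤ) = k from Int.ediv_eq_of_eq_mul_right hg' hk] at h3
  set g := Int.gcd J K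
  have hgZ : (1 : ℤ) ≤ g := by exact_mod_cast hg
  have hgR : (1 : ℝ) ≤ g := by exact_mod_cast hg
  have hkpos : 0 < k := by
    by_contra h
    have : (g : ℤ) * k ≤ 0 := mul_nonpos_of_nonneg_of_nonpos (by omega) (by omega)
    omega
  have hkR : (0 : ℝ) < k := by exact_mod_cast hkpos
  have hkL : (k : ℝ) ≤ L := by
    have a1 : (K : ℝ) = g * k := by exact_mod_cast hk
    have a2 : (K : ℝ) ≤ L := by
      rw [hK]; push_cast
      exact (le_abs_self _).trans (h2 q hq p hp)
    nlinarith
  have heδ : |(j : ℝ) - k * y| ≤ 2 * δ := by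
    have a1 : (K : ℝ) = g * k := by exact_mod_cast hk
    have a2 : (J : ℝ) = g * j := by exact_mod_cast hj
    have a3 : |(J : ℝ) - K * y| ≤ 2 * δ := by
      rw [hJ, hK]; push_cast
      calc |((q.1 : ℝ) - p.1) - (q.2 - p.2) * y| = |((q.1 : ℝ) - q.2 * y) - (p.1 - p.2 * y)| := by
            congr 1; ring
        _ ≤ _ := (abs_sub _ _).trans (by linarith [h1 p hp, h1 q hq])
    have a4 : (J : ℝ) - K * y = g * (j - k * y) := by rw [a1, a2]; ring
    rw [a4, abs_mul, abs_of_nonneg (by positivity : (0 : ℝ) ≤ g)] at a3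
    nlinarith [abs_nonneg ((j : ℝ) - k * y)]
  obtain ⟨r, hr1, hr2, hr3⟩ := card_le_along_direction (Finset.card_pos.mp (by omega)) hδ hL h1 h2
    hkpos hcop
  refine ⟨j, k, hkpos, r, hr1, hr2, hr3.trans ?_⟩
  -- Expanding (2kδ + L|e| + 1)(r + 1) with e = j - ky, each of the four terms involving δ or e is
  -- at most 2δL, and r + 1 remains.
  have b1 : (k : ℝ) * δ ≤ L * δ := by gcongr
  have b2 : L * |(j : ℝ) - k * y| ≤ L * (2 * δ) := by gcongr
  have b3 : δ * (r * k) ≤ δ * L := by gcongr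
  have b4 : L * (r * |(j : ℝ) - k * y|) ≤ L * (2 * δ) := by gcongr
  nlinarith

/-- The wide case: at most 2δ + 1 points on each of at most L + 1 horizontal lines. -/
lemma card_le_of_half_le {P : Finset (ℤ × ℤ)} {y δ L : ℝ} (hδ : 1 / 2 ≤ δ) (hL : 1 ≤ L)
    (h1 : ∀ p ∈ P, |(p.1 : ℝ) - p.2 * y| ≤ δ)
    (h2 : ∀ p ∈ P, ∀ q ∈ P, |(p.2 : ℝ) - q.2| ≤ L) : (P.card : ℝ) ≤ 8 * δ * L := by
  classical
  have hfib : ∀ c ∈ P.image Prod.snd, (P.filter (fun p => p.2 = c)).card ≤ ⌊2 * δ + 1⌋₊ := by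
    intro c _
    refine Nat.le_floor ?_
    rw [← Finset.card_image_of_injOn (f := Prod.fst)]
    · refine card_le_of_sub_le (by positivity) ?_
      intro a ha b hb
      obtain ⟨p, hp, rfl⟩ := Finset.mem_image.mp ha
      obtain ⟨q, hq, rfl⟩ := Finset.mem_image.mp hb
      rw [Finset.mem_filter] at hp hq
      have a1 := abs_le.mp (h1 p hp.1)
      have a2 := abs_le.mp (h1 q hq.1)
      rw [hp.2] at a1
      rw [hq.2] at a2
      push_cast
      linarith [a1.1, a2.2]
    · intro a ha b hb hab
      rw [Finset.mem_coe, Finset.mem_filter] at ha hb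
      exact Prod.ext hab (ha.2.trans hb.2.symm)
  have h3 := Finset.card_le_mul_card_image P _ hfib
  have h4 : ((P.image Prod.snd).card : ℝ) ≤ L + 1 := by
    refine card_le_of_sub_le (by positivity) ?_
    intro a ha b hb
    obtain ⟨p, hp, rfl⟩ := Finset.mem_image.mp ha
    obtain ⟨q, hq, rfl⟩ := Finset.mem_image.mp hb
    push_cast
    exact (le_abs_self _).trans (h2 q hq p hp)
  have h5 : (P.card : ℝ) ≤ (⌊2 * δ + 1⌋₊ : ℝ) * (P.image Prod.snd).card := by exact_mod_cast h3
  calc (P.card : ℝ) ≤ (⌊2 * δ + 1⌋₊ : ℝ) * (P.image Prod.snd).card := h5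
    _ ≤ (2 * δ + 1) * (L + 1) := by
        gcongr
        exact Nat.floor_le (by positivity)
    _ ≤ _ := by nlinarith

end Lattice

/-! ### Quotients near e^u and rationals of small height -/

section Count

lemma half_abs_le_abs_exp_sub_one {x : ℝ} (hx : |x| ≤ 1) : |x| / 2 ≤ |Real.exp x - 1| := by
  rcases le_total 0 x with h | h
  · rw [abs_of_nonneg h]
    have := Real.add_one_le_exp x
    exact le_trans (by linarith) (le_abs_self _)
  · rw [abs_of_nonpos h] at hx ⊢
    have h1 := Real.add_one_le_exp (-x)
    have h2 : Real.exp (-x) * Real.exp x = 1 := by rw [← Real.exp_add]; simp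
    have h3 := Real.exp_pos x
    rw [abs_sub_comm]
    refine le_trans ?_ (le_abs_self _)
    nlinarith

/-- A direction with a long progression is a rational point close to `e^u`. -/
lemma progression_length_le {M Δ u : ℝ} (hM : 84 ≤ M) (hΔ : 1 ≤ Δ) (hu : |u| ≤ 3)
    {j k : ℤ} (hk : 0 < k) {r : ℝ} (hr : 8 * M ^ 2 / Δ < r) (h1 : r * k ≤ 3 * M)
    (h2 : r * |(j : ℝ) - k * Real.exp u| ≤ 2 * (8 * M / Δ)) :
    0 < j ∧ (j : ℝ) ≤ 12 * Δ / M ∧ (k : ℝ) ≤ 12 * Δ / M ∧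
      |u - (Real.log j - Real.log k)| ≤ 1 ∧
      r * (1 + Δ * |u - (Real.log j - Real.log k)| / 224) ≤
        36 * M * ((Real.sqrt j)⁻¹ * (Real.sqrt k)⁻¹) := by
  have hM0 : 0 < M := by linarith
  have hΔ0 : 0 < Δ := by linarith
  have hr0 : 0 < r := lt_trans (by positivity) hr
  have hk1 : (1 : ℝ) ≤ k := by exact_mod_cast hk
  set y := Real.exp u with hy
  set e := (j : ℝ) - k * y with he
  have hrΔ : 8 * M ^ 2 < r * Δ := by rwa [div_lt_iff₀ hΔ0] at hr
  have he3 : Real.exp 3 ≤ 21 := by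
    have h := Real.exp_one_lt_d9
    have : Real.exp 3 = Real.exp 1 ^ 3 := by rw [← Real.exp_nat_mul]; norm_num
    rw [this]
    calc Real.exp 1 ^ 3 ≤ 2.7182818286 ^ 3 := by gcongr
      _ ≤ 21 := by norm_num
  have hy1 : y ≤ 21 := (Real.exp_le_exp.mpr (abs_le.mp hu).2).trans he3
  have hy2 : 1 / 21 ≤ y := by
    have h := Real.exp_le_exp.mpr (abs_le.mp hu).1
    rw [Real.exp_neg] at h
    refine le_trans ?_ h
    rw [one_div]
    exact inv_anti₀ (Real.exp_pos _) he3
  have hy0 : 0 < y := Real.exp_pos u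
  have h2' : r * Δ * |e| ≤ 16 * M := by
    calc r * Δ * |e| = r * |e| * Δ := by ring
      _ ≤ 2 * (8 * M / Δ) * Δ := by gcongr
      _ = 16 * M := by field_simp; norm_num
  have heM : |e| * M ≤ 2 := by
    have h3 : 8 * M ^ 2 * |e| ≤ 16 * M := le_trans (by gcongr) h2'
    refine le_of_mul_le_mul_left ?_ (by positivity : 0 < 8 * M)
    linarith
  -- The threshold 84 is chosen so that |e| is at most half of 1/21 ≤ e^{-3} ≤ ky, which forces j >
  -- 0 and a relative error at most 1/2.
  have he42 : |e| ≤ 1 / 42 := by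
    have h3 : |e| * 84 ≤ |e| * M := by gcongr
    linarith
  have hkM : (k : ℝ) * (8 * M) ≤ 3 * Δ := by
    have h3 : 8 * M ^ 2 * k ≤ 3 * M * Δ := by
      calc 8 * M ^ 2 * k ≤ r * Δ * k := by gcongr
        _ = r * k * Δ := by ring
        _ ≤ _ := by gcongr
    refine le_of_mul_le_mul_left ?_ hM0
    linarith
  have hkylow : (k : ℝ) * (1 / 21) ≤ k * y := by gcongr
  have hky : 1 / 21 ≤ (k : ℝ) * y := by linarith
  have hkyhigh : (k : ℝ) * y ≤ k * 21 := by gcongr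
  have hje := abs_le.mp he42
  have hj0 : (0 : ℝ) < j := by rw [he] at hje; linarith [hje.1]
  -- With k ≤ 3Δ/(8M) this gives the height bound 32 · 3/8 = 12, and √(jk) ≤ 6k below.
  have hj32 : (j : ℝ) ≤ 32 * k := by rw [he] at hje; linarith [hje.2]
  have hk0 : (0 : ℝ) < k := by linarith
  set v := u - (Real.log j - Real.log k) with hv
  have hev : Real.exp (-v) = j / (k * y) := by
    rw [hv, show -(u - (Real.log j - Real.log k)) = Real.log j - Real.log k - u by ring,
      Real.exp_sub, Real.exp_sub, Real.exp_log hj0, Real.exp_log hk0, div_div]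
  have hkypos : 0 < (k : ℝ) * y := by positivity
  have hρ : Real.exp (-v) - 1 = e / (k * y) := by
    rw [hev, he]; field_simp
  have hρ1 : |Real.exp (-v) - 1| ≤ 1 / 2 := by
    rw [hρ, abs_div, abs_of_pos hkypos, div_le_iff₀ hkypos]
    linarith
  have hv1 : |v| ≤ 1 := by
    have h3 := abs_le.mp hρ1
    rw [abs_le]
    constructor
    · by_contra hc
      have := Real.add_one_le_exp (-v)
      linarith
    · by_contra hc
      have h4 := Real.add_one_le_exp v
      have h5 : Real.exp v * Real.exp (-v) = 1 := by rw [← Real.exp_add]; simp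
      have h6 : 2 * Real.exp (-v) < Real.exp v * Real.exp (-v) := by
        gcongr
        linarith
      linarith
  have hve : (k : ℝ) * |v| ≤ 42 * |e| := by
    have h3 := half_abs_le_abs_exp_sub_one (x := -v) (by rwa [abs_neg])
    rw [hρ, abs_neg, abs_div, abs_of_pos hkypos, le_div_iff₀ hkypos] at h3
    have h4 : |v| / 2 * (k * (1 / 21)) ≤ |v| / 2 * (k * y) := by gcongr
    linarith
  refine ⟨by exact_mod_cast hj0, ?_, ?_, hv1, ?_⟩
  · rw [le_div_iff₀ hM0]
    have h3 : (j : ℝ) * M ≤ 32 * k * M := by gcongr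
    linarith
  · rw [le_div_iff₀ hM0]
    linarith
  · have h3 : r * k * (1 + Δ * |v| / 224) ≤ 6 * M := by
      have h4 : r * Δ * (k * |v|) ≤ r * Δ * (42 * |e|) := by gcongr
      have h5 : r * k * (1 + Δ * |v| / 224) = r * k + r * Δ * (k * |v|) / 224 := by ring
      rw [h5]
      linarith
    have hs : Real.sqrt j * Real.sqrt k ≤ 6 * k := by
      rw [← Real.sqrt_mul hj0.le]
      rw [Real.sqrt_le_left (by positivity)]
      have h4 : (j : ℝ) * k ≤ 32 * k * k := by gcongr
      have h5 := mul_pos hk0 hk0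
      linarith
    have hsp : 0 < Real.sqrt j * Real.sqrt k :=
      mul_pos (Real.sqrt_pos.mpr hj0) (Real.sqrt_pos.mpr hk0)
    rw [← mul_inv, ← div_eq_mul_inv, le_div_iff₀ hsp]
    calc r * (1 + Δ * |v| / 224) * (Real.sqrt j * Real.sqrt k)
        ≤ r * (1 + Δ * |v| / 224) * (6 * k) := by gcongr
      _ = 6 * (r * k * (1 + Δ * |v| / 224)) := by ring
      _ ≤ _ := by linarith

/-- The number of quotients `m / n` with `m, n ∈ [M, 4M]` near `e^u`, compared with the rationals
of small height near `e^u`. -/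
lemma card_quotients_le {M : ℕ} {Δ u : ℝ} (hM : 84 ≤ M) (hΔ : 1 ≤ Δ) (hΔM : Δ ≤ (M : ℝ) ^ 2)
    (hu : |u| ≤ 3) :
    (((Finset.Icc M (4 * M) ×ˢ Finset.Icc M (4 * M)).filter
      (fun p : ℕ × ℕ => |u - (Real.log p.1 - Real.log p.2)| ≤ 1 / Δ)).card : ℝ) ≤
    201 * (M : ℝ) ^ 2 / Δ + ∑ j ∈ Finset.Icc 1 ⌊12 * Δ / M⌋₊, ∑ k ∈ Finset.Icc 1 ⌊12 * Δ / M⌋₊,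
      invSqrt j * invSqrt k *
        (if |u - (Real.log j - Real.log k)| ≤ 1 then
          36 * M / (1 + Δ * |u - (Real.log j - Real.log k)| / 224) else 0) := by
  classical
  set S := (Finset.Icc M (4 * M) ×ˢ Finset.Icc M (4 * M)).filter
      (fun p : ℕ × ℕ => |u - (Real.log p.1 - Real.log p.2)| ≤ 1 / Δ) with hS
  have hΔ0 : 0 < Δ := by linarith
  have hM84 : (84 : ℝ) ≤ M := by exact_mod_cast hM
  have hM0 : (0 : ℝ) < M := by linarith
  have hterm : ∀ j k : ℕ, 0 ≤ invSqrt j * invSqrt k *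
        (if |u - (Real.log j - Real.log k)| ≤ 1 then
          36 * M / (1 + Δ * |u - (Real.log j - Real.log k)| / 224) else 0) := by
    intro j k
    have := invSqrt_nonneg j
    have := invSqrt_nonneg k
    refine mul_nonneg (by positivity) ?_
    split_ifs <;> positivity
  set W := ∑ j ∈ Finset.Icc 1 ⌊12 * Δ / M⌋₊, ∑ k ∈ Finset.Icc 1 ⌊12 * Δ / M⌋₊,
      invSqrt j * invSqrt k *
        (if |u - (Real.log j - Real.log k)| ≤ 1 then
          36 * M / (1 + Δ * |u - (Real.log j - Real.log k)| / 224) else 0) with hW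
  have hW0 : 0 ≤ W := Finset.sum_nonneg fun j _ => Finset.sum_nonneg fun k _ => hterm j k
  have hA1 : 1 ≤ (M : ℝ) ^ 2 / Δ := by rwa [le_div_iff₀ hΔ0, one_mul]
  rw [mul_div_assoc]
  set B := (M : ℝ) ^ 2 / Δ with hB
  set P : Finset (ℤ × ℤ) := S.image (fun p => ((p.1 : ℤ), (p.2 : ℤ))) with hP
  have hcard : P.card = S.card := Finset.card_image_of_injective _ fun a b hab => by
    simp only [Prod.mk.injEq, Nat.cast_inj] at hab
    exact Prod.ext hab.1 hab.2
  rw [← hcard]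
  have h1 : ∀ p ∈ P, |(p.1 : ℝ) - p.2 * Real.exp u| ≤ 8 * M / Δ := by
    intro p hp
    obtain ⟨⟨m, n⟩, hmn, rfl⟩ := Finset.mem_image.mp hp
    simp only [hS, Finset.mem_filter, Finset.mem_product, Finset.mem_Icc] at hmn
    obtain ⟨⟨⟨hm1, hm2⟩, hn1, hn2⟩, hlog⟩ := hmn
    push_cast
    have hm0 : (0 : ℝ) < m := by exact_mod_cast (by omega : 0 < m)
    have hn0 : (0 : ℝ) < n := by exact_mod_cast (by omega : 0 < n)
    set θ := u - (Real.log m - Real.log n) with hθ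
    have hθ1 : |θ| ≤ 1 := hlog.trans (by rw [div_le_one hΔ0]; exact hΔ)
    have h3 : (n : ℝ) * Real.exp u = m * Real.exp θ := by
      rw [show u = θ + Real.log m - Real.log n by rw [hθ]; ring, Real.exp_sub, Real.exp_add,
        Real.exp_log hm0, Real.exp_log hn0]
      field_simp
    rw [h3, show (m : ℝ) - m * Real.exp θ = -(m * (Real.exp θ - 1)) by ring, abs_neg, abs_mul,
      abs_of_pos hm0]
    have hm4 : (m : ℝ) ≤ 4 * M := by exact_mod_cast hm2
    calc (m : ℝ) * |Real.exp θ - 1| ≤ 4 * M * (2 * (1 / Δ)) := by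
          gcongr
          exact (Real.abs_exp_sub_one_le hθ1).trans (by gcongr)
      _ = 8 * M / Δ := by ring
  have h2 : ∀ p ∈ P, ∀ q ∈ P, |(p.2 : ℝ) - q.2| ≤ 3 * M := by
    intro p hp q hq
    obtain ⟨⟨m, n⟩, hmn, rfl⟩ := Finset.mem_image.mp hp
    obtain ⟨⟨m', n'⟩, hmn', rfl⟩ := Finset.mem_image.mp hq
    simp only [hS, Finset.mem_filter, Finset.mem_product, Finset.mem_Icc] at hmn hmn'
    have a1 : (M : ℝ) ≤ n := by exact_mod_cast hmn.1.2.1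
    have a2 : (n : ℝ) ≤ 4 * M := by exact_mod_cast hmn.1.2.2
    have a3 : (M : ℝ) ≤ n' := by exact_mod_cast hmn'.1.2.1
    have a4 : (n' : ℝ) ≤ 4 * M := by exact_mod_cast hmn'.1.2.2
    push_cast
    rw [abs_le]
    constructor <;> linarith
  -- The constant 201 is 192 from the area, 8 from progressions too short to be useful, and 1 from
  -- the additive one, as M²/Δ ≥ 1.
  have hδL : 8 * (8 * M / Δ) * (3 * M) = 192 * B := by rw [hB]; ring
  rcases le_or_gt (1 / 2) (8 * M / Δ) with hδ | hδ
  · have := card_le_of_half_le hδ (by linarith) h1 h2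
    rw [hδL] at this
    linarith
  rcases Nat.lt_or_ge 1 P.card with hP1 | hP1
  swap
  · have : (P.card : ℝ) ≤ 1 := by exact_mod_cast hP1
    linarith
  obtain ⟨j, k, hk, r, hr1, hr2, hr3⟩ := exists_direction_card_le hP1 (by positivity) hδ
    (by positivity) h1 h2
  rw [hδL] at hr3
  rcases le_or_gt (r : ℝ) (8 * (M : ℝ) ^ 2 / Δ) with hr | hr
  · rw [mul_div_assoc, ← hB] at hr
    linarith
  obtain ⟨hj, hjK, hkK, hv, hmain⟩ := progression_length_le hM84 hΔ hu hk hr hr1 hr2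
  lift j to ℕ using hj.le
  lift k to ℕ using hk.le
  have hle : (r : ℝ) ≤ W := by
    have hjm : j ∈ Finset.Icc 1 ⌊12 * Δ / M⌋₊ := Finset.mem_Icc.mpr
      ⟨by exact_mod_cast hj, Nat.le_floor (by exact_mod_cast hjK)⟩
    have hkm : k ∈ Finset.Icc 1 ⌊12 * Δ / M⌋₊ := Finset.mem_Icc.mpr
      ⟨by exact_mod_cast hk, Nat.le_floor (by exact_mod_cast hkK)⟩
    refine le_trans ?_ ((Finset.single_le_sum (fun k _ => hterm j k) hkm).trans
      (Finset.single_le_sum (f := fun j => ∑ k ∈ Finset.Icc 1 ⌊12 * Δ / M⌋₊, invSqrt j * invSqrt k *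
        (if |u - (Real.log j - Real.log k)| ≤ 1 then
          36 * M / (1 + Δ * |u - (Real.log j - Real.log k)| / 224) else 0))
        (fun j _ => Finset.sum_nonneg fun k _ => hterm j k) hjm))
    push_cast at hv hmain
    rw [if_pos hv, mul_div_assoc', le_div_iff₀ (by positivity)]
    unfold invSqrt
    linarith
  linarith

end Count

/-! ### Passing between sums over quotients and integrals -/

section Duality

lemma continuous_norm_weightSum_sq {ι : Type*} (A : Finset ι) (t γ : ι → ℝ) :
    Continuous fun u => ‖weightSum A t γ u‖ ^ 2 := by
  unfold weightSum; fun_prop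

/-- A kernel truncated to `|u - x| ≤ h`, integrated against a continuous function, localizes. -/
lemma ite_mul_eq_indicator {g f : ℝ → ℝ} {x h : ℝ} :
    (fun u => (if |u - x| ≤ h then g (u - x) else 0) * f u) =
      (Set.Icc (x - h) (x + h)).indicator (fun u => g (u - x) * f u) := by
  ext u
  by_cases hu : |u - x| ≤ h
  · rw [if_pos hu, Set.indicator_of_mem]
    have := abs_le.mp hu
    exact ⟨by linarith [this.1], by linarith [this.2]⟩
  · rw [if_neg hu, Set.indicator_of_notMem, zero_mul]
    rintro ⟨h1, h2⟩
    exact hu (abs_le.mpr ⟨by linarith, by linarith⟩)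

lemma integrable_ite_mul {g f : ℝ → ℝ} (hg : Continuous g) (hf : Continuous f) (x h : ℝ) :
    MeasureTheory.Integrable (fun u => (if |u - x| ≤ h then g (u - x) else 0) * f u) := by
  rw [ite_mul_eq_indicator, MeasureTheory.integrable_indicator_iff measurableSet_Icc]
  exact (by fun_prop : Continuous fun u => g (u - x) * f u).continuousOn.integrableOn_Icc

lemma integral_ite_mul {g f : ℝ → ℝ} {x h : ℝ} (hh : 0 ≤ h) :
    ∫ u, (if |u - x| ≤ h then g (u - x) else 0) * f u = ∫ v in -h..h, g v * f (x + v) := by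
  rw [ite_mul_eq_indicator, MeasureTheory.integral_indicator measurableSet_Icc,
    MeasureTheory.integral_Icc_eq_integral_Ioc, ← intervalIntegral.integral_of_le (by linarith)]
  have := intervalIntegral.integral_comp_add_left (a := -h) (b := h)
    (fun u => g (u - x) * f u) x
  simp only [add_sub_cancel_left] at this
  rw [this, ← sub_eq_add_neg]

lemma integral_inv_one_add_abs_le {Δ : ℝ} (hΔ : 1 ≤ Δ) :
    ∫ v in (-1 : ℝ)..1, 1 / (1 + Δ * |v| / 224) ≤ 448 * Real.log (1 + Δ) / Δ := by
  have hΔ0 : 0 < Δ := by linarith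
  set a := Δ / 224 with ha
  have ha0 : 0 < a := by positivity
  have hpos : ∀ v : ℝ, 0 < 1 + Δ * |v| / 224 := fun v => by positivity
  have hcont : Continuous fun v : ℝ => 1 / (1 + Δ * |v| / 224) := by
    refine Continuous.div (by fun_prop) (by fun_prop) fun v => (hpos v).ne'
  have h1 : ∫ v in (0 : ℝ)..1, 1 / (1 + Δ * |v| / 224) = Real.log (1 + a) / a := by
    have : ∀ v ∈ Set.uIcc (0 : ℝ) 1, HasDerivAt (fun v => Real.log (1 + a * v) / a)
        (1 / (1 + Δ * |v| / 224)) v := by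
      intro v hv
      rw [Set.uIcc_of_le (by norm_num)] at hv
      have hv0 : 0 < 1 + a * v := by have := hv.1; positivity
      have h := ((((hasDerivAt_id v).const_mul a).const_add 1).log hv0.ne').div_const a
      convert! h using 1
      rw [abs_of_nonneg hv.1, ha]
      simp only [id]
      field_simp
    rw [intervalIntegral.integral_eq_sub_of_hasDerivAt this (hcont.intervalIntegrable _ _)]
    simp
  have h2 : ∫ v in (-1 : ℝ)..0, 1 / (1 + Δ * |v| / 224) = Real.log (1 + a) / a := by
    rw [← h1]
    have := intervalIntegral.integral_comp_neg (a := 0) (b := 1)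
      (fun v : ℝ => 1 / (1 + Δ * |v| / 224))
    simp only [abs_neg, neg_zero] at this
    exact this.symm
  rw [← intervalIntegral.integral_add_adjacent_intervals (hcont.intervalIntegrable (-1) 0)
    (hcont.intervalIntegrable 0 1), h1, h2]
  have h3 : Real.log (1 + a) ≤ Real.log (1 + Δ) := by
    refine Real.log_le_log (by positivity) ?_
    rw [ha]; linarith
  have h4 : Real.log (1 + a) / a = 224 * Real.log (1 + a) / Δ := by rw [ha]; field_simp
  rw [h4, ← add_div]
  gcongr
  linarith

variable {ι : Type*} {A : Finset ι} {t γ : ι → ℝ}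

/-- The energy is at most twice each of its shifts by |v| ≤ 1/Δ; averaging over this interval of
length 2/Δ and substituting u = log m - log n + v turns the double sum into a count at u. -/
lemma crossEnergy_block_le_integral (hγ : ∀ r, 0 ≤ γ r) {Δ : ℝ} (hΔ : 1 ≤ Δ)
    (ht : ∀ r ∈ A, ∀ s ∈ A, |t r - t s| ≤ Δ) {M : ℕ} (hM : 0 < M) :
    crossEnergy A A t γ (Finset.Icc M (4 * M)) (fun _ => ((1 : ℝ) : ℂ)) ≤
      Δ * ∫ u in Set.Icc (-3 : ℝ) 3,
        (((Finset.Icc M (4 * M) ×ˢ Finset.Icc M (4 * M)).filter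
          (fun p : ℕ × ℕ => |u - (Real.log p.1 - Real.log p.2)| ≤ 1 / Δ)).card : ℝ) *
          ‖weightSum A t γ u‖ ^ 2 := by
  have hΔ0 : 0 < Δ := by linarith
  set f : ℝ → ℝ := fun u => ‖weightSum A t γ u‖ ^ 2 with hf
  have hfc : Continuous f := continuous_norm_weightSum_sq A t γ
  set X := Finset.Icc M (4 * M) with hX
  have hint : ∀ p : ℕ × ℕ, MeasureTheory.Integrable (fun u =>
      (if |u - (Real.log p.1 - Real.log p.2)| ≤ 1 / Δ then (1 : ℝ) else 0) * f u) := fun p =>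
    integrable_ite_mul (g := fun _ => 1) continuous_const hfc _ _
  have hset : ∀ p ∈ X ×ˢ X, ∫ u in Set.Icc (-3 : ℝ) 3,
      (if |u - (Real.log p.1 - Real.log p.2)| ≤ 1 / Δ then (1 : ℝ) else 0) * f u =
      ∫ v in -(1 / Δ)..(1 / Δ), f (Real.log p.1 - Real.log p.2 + v) := by
    intro p hp
    rw [MeasureTheory.setIntegral_eq_integral_of_forall_compl_eq_zero]
    · rw [integral_ite_mul (g := fun _ => 1) (by positivity)]
      simp only [one_mul]
    · intro u hu
      -- Outside [-3, 3] nothing is counted: |log m - log n| ≤ log 4 ≤ 2 and 1/Δ ≤ 1.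
      rw [if_neg, zero_mul]
      intro hc
      apply hu
      simp only [hX, Finset.mem_product, Finset.mem_Icc] at hp
      obtain ⟨⟨h1, h2⟩, h3, h4⟩ := hp
      have hM0 : (0 : ℝ) < M := by exact_mod_cast hM
      have hl4 : Real.log 4 ≤ 2 := by
        rw [show (4 : ℝ) = 2 ^ 2 by norm_num, Real.log_pow]
        have := Real.log_two_lt_d9
        push_cast
        linarith
      have hlog : ∀ n : ℕ, M ≤ n → n ≤ 4 * M →
          Real.log M ≤ Real.log n ∧ Real.log n ≤ Real.log M + 2 := by
        intro n hn1 hn2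
        refine ⟨Real.log_le_log hM0 (by exact_mod_cast hn1), ?_⟩
        have h5 : Real.log n ≤ Real.log (4 * M) :=
          Real.log_le_log (by exact_mod_cast (by omega : 0 < n)) (by exact_mod_cast hn2)
        rw [Real.log_mul (by norm_num) hM0.ne'] at h5
        linarith
      have b1 := hlog _ h1 h2
      have b2 := hlog _ h3 h4
      have b3 : 1 / Δ ≤ 1 := by rw [div_le_one hΔ0]; exact hΔ
      have b4 := abs_le.mp hc
      exact ⟨by linarith [b1.1, b2.2, b4.1], by linarith [b1.2, b2.1, b4.2]⟩
  have hR : ∫ u in Set.Icc (-3 : ℝ) 3, (((X ×ˢ X).filter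
      (fun p : ℕ × ℕ => |u - (Real.log p.1 - Real.log p.2)| ≤ 1 / Δ)).card : ℝ) * f u =
      ∫ v in -(1 / Δ)..(1 / Δ), ∑ m ∈ X, ∑ n ∈ X, f (Real.log m - Real.log n + v) := by
    have e1 : ∀ u, (((X ×ˢ X).filter
        (fun p : ℕ × ℕ => |u - (Real.log p.1 - Real.log p.2)| ≤ 1 / Δ)).card : ℝ) * f u =
        ∑ p ∈ X ×ˢ X,
          (if |u - (Real.log p.1 - Real.log p.2)| ≤ 1 / Δ then (1 : ℝ) else 0) * f u := by
      intro u
      rw [← Finset.sum_mul, Finset.sum_boole]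
    simp_rw [e1]
    rw [MeasureTheory.integral_finsetSum _ (fun p _ => (hint p).integrableOn),
      Finset.sum_congr rfl hset, Finset.sum_product, intervalIntegral.integral_finsetSum]
    · refine Finset.sum_congr rfl fun m _ => ?_
      rw [intervalIntegral.integral_finsetSum]
      exact fun n _ => (by fun_prop : Continuous _).intervalIntegrable _ _
    · exact fun m _ => (by fun_prop : Continuous _).intervalIntegrable _ _
  rw [hR]
  set E := crossEnergy A A t γ X (fun _ => ((1 : ℝ) : ℂ)) with hE
  have hmono : ∫ _v in -(1 / Δ)..(1 / Δ), E / 2 ≤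
      ∫ v in -(1 / Δ)..(1 / Δ), ∑ m ∈ X, ∑ n ∈ X, f (Real.log m - Real.log n + v) := by
    refine intervalIntegral.integral_mono_on (by have : 0 < 1 / Δ := by positivity
                                                 linarith)
      (continuous_const.intervalIntegrable _ _)
      ((by fun_prop : Continuous _).intervalIntegrable _ _) fun v hv => ?_
    have := crossEnergy_le_two_mul_shift (A := A) (t := t) hγ X (fun _ => 1) hΔ0 ht
      (abs_le.mpr hv)
    simp only [one_mul] at this
    linarith
  rw [intervalIntegral.integral_const, smul_eq_mul] at hmono
  have h3 : Δ * ((1 / Δ - -(1 / Δ)) * (E / 2)) = E := by field_simp; ring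
  calc E = Δ * ((1 / Δ - -(1 / Δ)) * (E / 2)) := h3.symm
    _ ≤ _ := by gcongr

/-- With v = u - log j + log k, the sum over j, k for fixed v is a shifted energy, hence at most the
unshifted one; the integral of the kernel supplies log(1 + Δ)/Δ. -/
lemma integral_height_le (hγ : ∀ r, 0 ≤ γ r) {Δ : ℝ} (hΔ : 1 ≤ Δ) {M : ℝ} (hM : 0 ≤ M) (K : ℝ) :
    ∑ j ∈ Finset.Icc 1 ⌊K⌋₊, ∑ k ∈ Finset.Icc 1 ⌊K⌋₊, ∫ u in Set.Icc (-3 : ℝ) 3,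
      invSqrt j * invSqrt k * ((if |u - (Real.log j - Real.log k)| ≤ 1 then
          36 * M / (1 + Δ * |u - (Real.log j - Real.log k)| / 224) else 0) *
            ‖weightSum A t γ u‖ ^ 2) ≤
      36 * M * (448 * Real.log (1 + Δ) / Δ) * zetaEnergy A t γ K := by
  have hΔ0 : 0 < Δ := by linarith
  set f : ℝ → ℝ := fun u => ‖weightSum A t γ u‖ ^ 2 with hf
  have hfc : Continuous f := continuous_norm_weightSum_sq A t γ
  set g : ℝ → ℝ := fun v => 36 * M / (1 + Δ * |v| / 224) with hg
  have hpos : ∀ v : ℝ, 0 < 1 + Δ * |v| / 224 := fun v => by positivity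
  have hgc : Continuous g := by
    refine Continuous.div (by fun_prop) (by fun_prop) fun v => (hpos v).ne'
  have hg0 : ∀ v, 0 ≤ g v := fun v => by have := hpos v; positivity
  have h1 : ∀ j k : ℕ, ∫ u in Set.Icc (-3 : ℝ) 3,
      invSqrt j * invSqrt k * ((if |u - (Real.log j - Real.log k)| ≤ 1 then
          g (u - (Real.log j - Real.log k)) else 0) * f u) ≤
      ∫ v in (-1 : ℝ)..1, g v * (invSqrt j * invSqrt k * f (Real.log j - Real.log k + v)) := by
    intro j k
    have hjk := mul_nonneg (invSqrt_nonneg j) (invSqrt_nonneg k)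
    rw [MeasureTheory.integral_const_mul]
    have e1 : ∫ v in (-1 : ℝ)..1, g v * (invSqrt j * invSqrt k *
        f (Real.log j - Real.log k + v)) = invSqrt j * invSqrt k *
        ∫ v in (-1 : ℝ)..1, g v * f (Real.log j - Real.log k + v) := by
      rw [← intervalIntegral.integral_const_mul]
      congr 1
      ext v
      ring
    rw [e1, ← integral_ite_mul zero_le_one]
    refine mul_le_mul_of_nonneg_left ?_ hjk
    refine MeasureTheory.setIntegral_le_integral (integrable_ite_mul hgc hfc _ _)
      (Filter.Eventually.of_forall fun u => ?_)
    refine mul_nonneg ?_ (by positivity)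
    split_ifs
    · exact hg0 _
    · exact le_rfl
  refine (Finset.sum_le_sum fun j _ => Finset.sum_le_sum fun k _ => h1 j k).trans ?_
  have h2 : ∑ j ∈ Finset.Icc 1 ⌊K⌋₊, ∑ k ∈ Finset.Icc 1 ⌊K⌋₊,
      ∫ v in (-1 : ℝ)..1, g v * (invSqrt j * invSqrt k * f (Real.log j - Real.log k + v)) =
      ∫ v in (-1 : ℝ)..1, g v * ∑ j ∈ Finset.Icc 1 ⌊K⌋₊, ∑ k ∈ Finset.Icc 1 ⌊K⌋₊,
        invSqrt j * invSqrt k * f (Real.log j - Real.log k + v) := by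
    simp_rw [Finset.mul_sum]
    rw [intervalIntegral.integral_finsetSum]
    · refine Finset.sum_congr rfl fun j _ => ?_
      rw [intervalIntegral.integral_finsetSum]
      exact fun k _ => (by fun_prop : Continuous _).intervalIntegrable _ _
    · exact fun j _ => (by fun_prop : Continuous _).intervalIntegrable _ _
  rw [h2]
  have h3 : ∫ v in (-1 : ℝ)..1, g v * ∑ j ∈ Finset.Icc 1 ⌊K⌋₊, ∑ k ∈ Finset.Icc 1 ⌊K⌋₊,
        invSqrt j * invSqrt k * f (Real.log j - Real.log k + v) ≤
      ∫ v in (-1 : ℝ)..1, g v * zetaEnergy A t γ K := by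
    refine intervalIntegral.integral_mono_on (by norm_num)
      ((by fun_prop : Continuous _).intervalIntegrable _ _)
      ((by fun_prop : Continuous _).intervalIntegrable _ _) fun v _ => ?_
    exact mul_le_mul_of_nonneg_left (sum_norm_weightSum_shift_le hγ _ _ v) (hg0 v)
  refine h3.trans ?_
  have h4 : ∫ v in (-1 : ℝ)..1, g v = 36 * M * ∫ v in (-1 : ℝ)..1, 1 / (1 + Δ * |v| / 224) := by
    rw [← intervalIntegral.integral_const_mul]
    congr 1
    ext v
    rw [mul_one_div]
  rw [intervalIntegral.integral_mul_const, h4]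
  have := zetaEnergy_nonneg (A := A) (t := t) hγ K
  gcongr
  exact integral_inv_one_add_abs_le hΔ

end Duality

/-! ### Duality for one block -/

section BlockDuality

/-- Duality: a block of length `M` is controlled by the mean value term and by the partial sum of
length `12 Δ / M`. -/
lemma exists_crossEnergy_block_le : ∃ C : ℝ, 1 ≤ C ∧ ∀ {ι : Type} (A : Finset ι) (t γ : ι → ℝ),
    (∀ r, 0 ≤ γ r) → (∀ r ∈ A, ∀ s ∈ A, r ≠ s → 1 ≤ |t r - t s|) → ∀ Δ : ℝ, 1 ≤ Δ →
      (∀ r ∈ A, ∀ s ∈ A, |t r - t s| ≤ Δ) → ∀ M : ℕ, 84 ≤ M → Δ ≤ (M : ℝ) ^ 2 →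
      crossEnergy A A t γ (Finset.Icc M (4 * M)) (fun n => (invSqrt n : ℂ)) ≤
        C * (M * ∑ r ∈ A, γ r ^ 2 + Real.log (1 + Δ) * zetaEnergy A t γ (12 * Δ / M)) := by
  classical
  obtain ⟨C₁, hC₁, hmean⟩ := exists_integral_norm_weightSum_sq_le
  refine ⟨201 * C₁ + 36 * 448, by linarith, ?_⟩
  intro ι A t γ hγ hsp Δ hΔ ht M hM hΔM
  have hΔ0 : 0 < Δ := by linarith
  have hM0 : (0 : ℝ) < M := by exact_mod_cast (by omega : 0 < M)
  set f : ℝ → ℝ := fun u => ‖weightSum A t γ u‖ ^ 2 with hf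
  have hfc : Continuous f := continuous_norm_weightSum_sq A t γ
  have hf0 : ∀ u, 0 ≤ f u := fun u => by positivity
  set K := 12 * Δ / M with hK
  set Q := ∑ r ∈ A, γ r ^ 2 with hQ
  set H := zetaEnergy A t γ K with hH
  have hH0 : 0 ≤ H := zetaEnergy_nonneg hγ K
  have hQ0 : 0 ≤ Q := Finset.sum_nonneg fun r _ => sq_nonneg _
  have hlog0 : 0 ≤ Real.log (1 + Δ) := Real.log_nonneg (by linarith)
  set w : ℕ → ℕ → ℝ → ℝ := fun j k u => invSqrt j * invSqrt k *
    ((if |u - (Real.log j - Real.log k)| ≤ 1 then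
      36 * M / (1 + Δ * |u - (Real.log j - Real.log k)| / 224) else 0) * f u) with hw
  have hpos : ∀ v : ℝ, 0 < 1 + Δ * |v| / 224 := fun v => by positivity
  have hwint : ∀ j k, MeasureTheory.Integrable (w j k) := fun j k =>
    (integrable_ite_mul (g := fun v => 36 * M / (1 + Δ * |v| / 224))
      (Continuous.div (by fun_prop) (by fun_prop) fun v => (hpos v).ne') hfc _ _).const_mul _
  have hfint : MeasureTheory.IntegrableOn f (Set.Icc (-3) 3) :=
    hfc.continuousOn.integrableOn_Icc
  have hsumint : MeasureTheory.Integrable (fun u => ∑ j ∈ Finset.Icc 1 ⌊K⌋₊,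
      ∑ k ∈ Finset.Icc 1 ⌊K⌋₊, w j k u) := MeasureTheory.integrable_finsetSum _ fun j _ =>
    MeasureTheory.integrable_finsetSum _ fun k _ => hwint j k
  have hcount : ∫ u in Set.Icc (-3 : ℝ) 3,
        (((Finset.Icc M (4 * M) ×ˢ Finset.Icc M (4 * M)).filter
          (fun p : ℕ × ℕ => |u - (Real.log p.1 - Real.log p.2)| ≤ 1 / Δ)).card : ℝ) * f u ≤
      201 * (M : ℝ) ^ 2 / Δ * (C₁ * Q) + 36 * M * (448 * Real.log (1 + Δ) / Δ) * H := by
    calc _ ≤ ∫ u in Set.Icc (-3 : ℝ) 3, (201 * (M : ℝ) ^ 2 / Δ * f u +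
          ∑ j ∈ Finset.Icc 1 ⌊K⌋₊, ∑ k ∈ Finset.Icc 1 ⌊K⌋₊, w j k u) := by
          refine MeasureTheory.integral_mono_of_nonneg
            (Filter.Eventually.of_forall fun u => mul_nonneg (Nat.cast_nonneg _) (hf0 u))
            ((hfint.const_mul _).add hsumint.integrableOn) ?_
          refine (MeasureTheory.ae_restrict_iff' measurableSet_Icc).mpr
            (Filter.Eventually.of_forall fun u hu => ?_)
          have h := card_quotients_le hM hΔ hΔM (abs_le.mpr hu)
          have h2 := mul_le_mul_of_nonneg_right h (hf0 u)
          rw [add_mul, Finset.sum_mul] at h2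
          simp_rw [Finset.sum_mul] at h2
          refine h2.trans (le_of_eq ?_)
          congr 1
          refine Finset.sum_congr rfl fun j _ => Finset.sum_congr rfl fun k _ => ?_
          rw [hw]
          ring
      _ = 201 * (M : ℝ) ^ 2 / Δ * (∫ u in Set.Icc (-3 : ℝ) 3, f u) +
          ∑ j ∈ Finset.Icc 1 ⌊K⌋₊, ∑ k ∈ Finset.Icc 1 ⌊K⌋₊,
            ∫ u in Set.Icc (-3 : ℝ) 3, w j k u := by
          rw [MeasureTheory.integral_add (hfint.const_mul _) hsumint.integrableOn,
            MeasureTheory.integral_const_mul, MeasureTheory.integral_finsetSum]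
          · congr 1
            refine Finset.sum_congr rfl fun j _ => ?_
            rw [MeasureTheory.integral_finsetSum]
            exact fun k _ => (hwint j k).integrableOn
          · exact fun j _ => (MeasureTheory.integrable_finsetSum _
              fun k _ => hwint j k).integrableOn
      _ ≤ _ := add_le_add (mul_le_mul_of_nonneg_left (hmean A t γ hγ hsp) (by positivity))
          (integral_height_le hγ hΔ hM0.le K)
  have hone := crossEnergy_block_le_integral hγ hΔ ht (by omega : 0 < M)
  -- Majorizing n^{-1/2} by M^{-1/2} on the block returns to unit coefficients and supplies the
  -- factor 1/M.
  have hcoef : crossEnergy A A t γ (Finset.Icc M (4 * M)) (fun n => (invSqrt n : ℂ)) ≤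
      ((Real.sqrt M)⁻¹) ^ 2 *
        crossEnergy A A t γ (Finset.Icc M (4 * M)) (fun _ => ((1 : ℝ) : ℂ)) := by
    rw [← crossEnergy_const_mul (Finset.Icc M (4 * M)) (fun _ => 1)]
    refine crossEnergy_mono (b := fun _ => (Real.sqrt M)⁻¹ * 1) subset_rfl (fun n hn => ?_)
      (fun n => by positivity)
    rw [Complex.norm_real, Real.norm_of_nonneg (invSqrt_nonneg n), mul_one]
    unfold invSqrt
    have : (M : ℝ) ≤ n := by exact_mod_cast (Finset.mem_Icc.mp hn).1
    gcongr
  rw [inv_pow, Real.sq_sqrt hM0.le] at hcoef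
  calc _ ≤ (M : ℝ)⁻¹ * (Δ * (201 * (M : ℝ) ^ 2 / Δ * (C₁ * Q) +
        36 * M * (448 * Real.log (1 + Δ) / Δ) * H)) := hcoef.trans (by gcongr; exact hone.trans (by gcongr))
    _ = 201 * C₁ * (M * Q) + 36 * 448 * (Real.log (1 + Δ) * H) := by field_simp
    _ ≤ _ := by
        have h1 : 0 ≤ (M : ℝ) * Q := by positivity
        have h2 : 0 ≤ Real.log (1 + Δ) * H := by positivity
        nlinarith [mul_nonneg hC₁.le h2]

end BlockDuality

/-! ### Bounds for partial sums of the zeta function -/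

section Bounds

/-- Duality for partial sums of the zeta function. -/
lemma exists_zetaEnergy_dual {ε : ℝ} (hε : 0 < ε) : ∃ C : ℝ, 1 ≤ C ∧
    ∀ {ι : Type} (A : Finset ι) (t γ : ι → ℝ), (∀ r, 0 ≤ γ r) →
      (∀ r ∈ A, ∀ s ∈ A, r ≠ s → 1 ≤ |t r - t s|) → ∀ Δ : ℝ, 1 ≤ Δ →
      (∀ r ∈ A, ∀ s ∈ A, |t r - t s| ≤ Δ) → ∀ M : ℝ, 168 ≤ M → 4 * Δ ≤ M ^ 2 →
      zetaEnergy A t γ M ≤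
        C * M ^ ε * (M * ∑ r ∈ A, γ r ^ 2 + zetaEnergy A t γ (24 * Δ / M)) := by
  obtain ⟨C₁, hC₁, h₁⟩ := exists_zetaEnergy_le_block (ε := ε / 2) (by positivity)
  obtain ⟨C₂, hC₂, h₂⟩ := exists_crossEnergy_block_le
  have hlogC : 0 < 2 / (ε / 2) := by positivity
  refine ⟨C₁ * C₂ * (1 + 2 / (ε / 2)), ?_, ?_⟩
  · have := one_le_mul_of_one_le_of_one_le hC₁ hC₂
    exact one_le_mul_of_one_le_of_one_le this (by linarith)
  intro ι A t γ hγ hsp Δ hΔ ht M hM hΔM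
  have hM0 : 0 < M := by linarith
  have hM1 : 1 ≤ M := by linarith
  obtain ⟨P, hP1, hP2, hP3⟩ := h₁ A t γ hγ M hM1
  have hP84 : 84 ≤ P := by
    have : (84 : ℝ) < P := by linarith
    exact_mod_cast this.le
  have hP0 : (0 : ℝ) < P := by linarith
  -- As P > M/2, the conditions M ≥ 168 and 4Δ ≤ M² become P ≥ 84 and Δ ≤ P², and 12Δ/P ≤ 24Δ/M.
  have hPM : M ^ 2 ≤ (2 * P) ^ 2 := by gcongr
  have hblock := h₂ A t γ hγ hsp Δ hΔ ht P hP84 (by linarith)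
  set Q := ∑ r ∈ A, γ r ^ 2 with hQ
  have hQ0 : 0 ≤ Q := Finset.sum_nonneg fun r _ => sq_nonneg _
  set H := zetaEnergy A t γ (24 * Δ / M) with hH
  have hH0 : 0 ≤ H := zetaEnergy_nonneg hγ _
  have hHP : zetaEnergy A t γ (12 * Δ / P) ≤ H := by
    refine zetaEnergy_mono ?_
    rw [div_le_div_iff₀ hP0 hM0]
    have : Δ * M ≤ Δ * (2 * P) := by gcongr
    linarith
  have hlog : Real.log (1 + Δ) ≤ 2 / (ε / 2) * M ^ (ε / 2) := by
    have h3 : Real.log (1 + Δ) ≤ Real.log (M ^ 2) := Real.log_le_log (by linarith) (by linarith)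
    rw [Real.log_pow] at h3
    have h4 := Real.log_le_rpow_div hM0.le (show 0 < ε / 2 by positivity)
    push_cast at h3
    calc _ ≤ 2 * Real.log M := h3
      _ ≤ 2 * (M ^ (ε / 2) / (ε / 2)) := by gcongr
      _ = _ := by ring
  have hMε : 1 ≤ M ^ (ε / 2) := Real.one_le_rpow hM1 (by positivity)
  have hlog0 : 0 ≤ Real.log (1 + Δ) := Real.log_nonneg (by linarith)
  have hsplit : M ^ ε = M ^ (ε / 2) * M ^ (ε / 2) := by
    rw [← Real.rpow_add hM0]; congr 1; ring
  calc zetaEnergy A t γ M ≤ C₁ * M ^ (ε / 2) * (C₂ * (P * Q + Real.log (1 + Δ) *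
        zetaEnergy A t γ (12 * Δ / P))) := hP3.trans (by gcongr)
    _ ≤ C₁ * M ^ (ε / 2) * (C₂ * (M * Q + 2 / (ε / 2) * M ^ (ε / 2) * H)) := by
        have := zetaEnergy_nonneg (A := A) (t := t) hγ (12 * Δ / P)
        gcongr
    _ ≤ C₁ * M ^ (ε / 2) * (C₂ * (((1 + 2 / (ε / 2)) * M ^ (ε / 2)) * (M * Q + H))) := by
        have h5 : 0 ≤ M * Q := by positivity
        have h6 : M * Q ≤ ((1 + 2 / (ε / 2)) * M ^ (ε / 2)) * (M * Q) :=
          le_mul_of_one_le_left h5 (one_le_mul_of_one_le_of_one_le (by linarith) hMε)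
        have h7 : 2 / (ε / 2) * M ^ (ε / 2) * H ≤ ((1 + 2 / (ε / 2)) * M ^ (ε / 2)) * H := by
          gcongr; linarith
        have h8 : M * Q + 2 / (ε / 2) * M ^ (ε / 2) * H ≤
            ((1 + 2 / (ε / 2)) * M ^ (ε / 2)) * (M * Q + H) := by
          rw [mul_add]; exact add_le_add h6 h7
        gcongr
    _ = _ := by rw [hsplit]; ring

/-- The dual length K may be below 1, so the ε-power is expressed through a larger parameter X ≥ 1.
-/
lemma exists_zetaEnergy_sq_le {ε : ℝ} (hε : 0 < ε) : ∃ C : ℝ, 1 ≤ C ∧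
    ∀ {ι : Type} (A : Finset ι) (t γ : ι → ℝ), (∀ r, 0 ≤ γ r) →
      ∀ K X : ℝ, 0 ≤ K → K ≤ X → 1 ≤ X →
      zetaEnergy A t γ K ^ 2 ≤ (∑ r ∈ A, γ r) ^ 2 * (C * X ^ ε * zetaEnergy A t γ (K ^ 2)) := by
  obtain ⟨C, hC, h⟩ := exists_card_divisors_le_rpow (ε := ε / 4) (by positivity)
  refine ⟨C ^ 2, one_le_pow₀ hC, ?_⟩
  intro ι A t γ hγ K X hK hKX hX
  have hX0 : 0 < X := by linarith
  have h1 := zetaEnergy_sq_le (A := A) (t := t) hγ hK (D := C * X ^ (ε / 2)) (by positivity) ?_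
  · refine h1.trans (le_of_eq ?_)
    have : X ^ ε = X ^ (ε / 2) * X ^ (ε / 2) := by
      rw [← Real.rpow_add hX0]; congr 1; ring
    rw [this]
    ring
  · intro n hn
    refine (h n).trans ?_
    have : X ^ (ε / 2) = (X ^ 2) ^ (ε / 4) := by
      rw [← Real.rpow_natCast, ← Real.rpow_mul hX0.le]; congr 1; push_cast; ring
    rw [this]
    have h2 : (n : ℝ) ≤ X ^ 2 := hn.trans (by gcongr)
    gcongr

/-- The bound for long partial sums. -/
lemma exists_zetaEnergy_le_of_sq_le_cube {ε : ℝ} (hε : 0 < ε) : ∃ C : ℝ, 1 ≤ C ∧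
    ∀ {ι : Type} (A : Finset ι) (t γ : ι → ℝ), (∀ r, 0 ≤ γ r) →
      (∀ r ∈ A, ∀ s ∈ A, r ≠ s → 1 ≤ |t r - t s|) → ∀ Δ : ℝ, 1 ≤ Δ →
      (∀ r ∈ A, ∀ s ∈ A, |t r - t s| ≤ Δ) → ∀ M : ℝ, 168 ≤ M → (24 * Δ) ^ 2 ≤ M ^ 3 →
      zetaEnergy A t γ M ≤ C * M ^ ε * ((∑ r ∈ A, γ r) ^ 2 + M * ∑ r ∈ A, γ r ^ 2) := by
  obtain ⟨C₁, hC₁, h₁⟩ := exists_zetaEnergy_dual (ε := ε / 3) (by positivity)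
  obtain ⟨C₂, hC₂, h₂⟩ := exists_zetaEnergy_sq_le (ε := ε / 3) (by positivity)
  refine ⟨2 * C₁ ^ 2 * C₂, ?_, ?_⟩
  · have := one_le_pow₀ hC₁ (n := 2)
    nlinarith
  intro ι A t γ hγ hsp Δ hΔ ht M hM hΔM
  have hM0 : 0 < M := by linarith
  have hM1 : 1 ≤ M := by linarith
  have hΔ0 : 0 < Δ := by linarith
  have h24 : 24 * Δ ≤ M ^ 2 := by
    refine le_of_sq_le_sq ?_ (by positivity)
    calc (24 * Δ) ^ 2 ≤ M ^ 3 := hΔM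
      _ ≤ M ^ 4 := pow_le_pow_right₀ hM1 (by norm_num)
      _ = _ := by ring
  have hdual := h₁ A t γ hγ hsp Δ hΔ ht M hM (by linarith)
  have hsq := h₂ A t γ hγ (24 * Δ / M) M (by positivity)
    (by rw [div_le_iff₀ hM0]; linarith) hM1
  set x := zetaEnergy A t γ M with hx
  set y := zetaEnergy A t γ (24 * Δ / M) with hy
  set G := ∑ r ∈ A, γ r with hG
  set Q := ∑ r ∈ A, γ r ^ 2 with hQ
  have hQ0 : 0 ≤ Q := Finset.sum_nonneg fun r _ => sq_nonneg _
  have hx0 : 0 ≤ x := zetaEnergy_nonneg hγ _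
  -- This is where (24Δ)² ≤ M³ enters: the squared dual length does not exceed M.
  have hxle : zetaEnergy A t γ ((24 * Δ / M) ^ 2) ≤ x := by
    refine zetaEnergy_mono ?_
    rw [div_pow, div_le_iff₀ (by positivity)]
    linarith
  set a := C₁ * M ^ (ε / 3) with ha
  set b := C₂ * M ^ (ε / 3) with hb
  have hMε : 1 ≤ M ^ (ε / 3) := Real.one_le_rpow hM1 (by positivity)
  have ha1 : 1 ≤ a := one_le_mul_of_one_le_of_one_le hC₁ hMε
  have hb1 : 1 ≤ b := one_le_mul_of_one_le_of_one_le hC₂ hMε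
  have hy2 : y ^ 2 ≤ G ^ 2 * (b * x) := hsq.trans (by gcongr)
  -- By AM-GM, a·y costs only x/2, which is absorbed into the left side.
  have hay : a * y ≤ (a ^ 2 * b * G ^ 2 + x) / 2 := by
    refine le_of_sq_le_sq ?_ (by positivity)
    have h3 : (a * y) ^ 2 ≤ a ^ 2 * b * G ^ 2 * x := by
      calc (a * y) ^ 2 = a ^ 2 * y ^ 2 := by ring
        _ ≤ a ^ 2 * (G ^ 2 * (b * x)) := by gcongr
        _ = _ := by ring
    have h4 := sq_nonneg (a ^ 2 * b * G ^ 2 - x)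
    linarith
  have hab : a ≤ a ^ 2 * b := by
    have h5 : a * 1 ≤ a * (a * b) := by
      gcongr; exact one_le_mul_of_one_le_of_one_le ha1 hb1
    linarith
  have hMQ : 0 ≤ M * Q := by positivity
  have h6 : a * (M * Q) ≤ a ^ 2 * b * (M * Q) := by gcongr
  have h7 : 0 ≤ a ^ 2 * b * G ^ 2 := by positivity
  have h8 : x ≤ 2 * (a ^ 2 * b) * (G ^ 2 + M * Q) := by linarith
  refine h8.trans (le_of_eq ?_)
  have : M ^ ε = M ^ (ε / 3) * M ^ (ε / 3) * M ^ (ε / 3) := by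
    rw [← Real.rpow_add hM0, ← Real.rpow_add hM0]; congr 1; ring
  rw [this, ha, hb]
  ring

/-- The bound for short partial sums, before optimization of the length. -/
lemma exists_zetaEnergy_le_short {ε : ℝ} (hε : 0 < ε) : ∃ C : ℝ, 1 ≤ C ∧
    ∀ {ι : Type} (A : Finset ι) (t γ : ι → ℝ), (∀ r, 0 ≤ γ r) →
      (∀ r ∈ A, ∀ s ∈ A, r ≠ s → 1 ≤ |t r - t s|) → ∀ Δ : ℝ, 1 ≤ Δ →
      (∀ r ∈ A, ∀ s ∈ A, |t r - t s| ≤ Δ) → ∀ M d q : ℝ, 168 ≤ M → 4 * Δ ≤ M ^ 2 →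
      0 ≤ d → d ^ 6 = Δ → 0 ≤ q → q ^ 2 = ∑ r ∈ A, γ r ^ 2 →
      zetaEnergy A t γ M ≤ C * (M * Δ) ^ ε *
        ((∑ r ∈ A, γ r) ^ 2 + M * q ^ 2 + (Δ / M + d ^ 2) * ((∑ r ∈ A, γ r) * q)) := by
  obtain ⟨C₁, hC₁, h₁⟩ := exists_zetaEnergy_dual (ε := ε / 2) (by positivity)
  obtain ⟨C₂, hC₂, h₂⟩ := exists_zetaEnergy_sq_le (ε := ε / 2) (by positivity)
  obtain ⟨C₃, hC₃, h₃⟩ := exists_zetaEnergy_le_of_sq_le_cube (ε := ε / 2) (by positivity)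
  set C₄ : ℝ := 24 * (C₂ * C₃ * 2 ^ (ε / 2)) with hC₄
  have h2ε : (1 : ℝ) ≤ 2 ^ (ε / 2) := Real.one_le_rpow (by norm_num) (by positivity)
  have hC₄1 : 1 ≤ C₂ * C₃ * 2 ^ (ε / 2) :=
    one_le_mul_of_one_le_of_one_le (one_le_mul_of_one_le_of_one_le hC₂ hC₃) h2ε
  refine ⟨C₁ * C₄, one_le_mul_of_one_le_of_one_le hC₁ (by linarith), ?_⟩
  intro ι A t γ hγ hsp Δ hΔ ht M d q hM hΔM hd hdΔ hq hqQ
  have hM0 : 0 < M := by linarith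
  have hM1 : 1 ≤ M := by linarith
  have hΔ0 : 0 < Δ := by linarith
  have hdual := h₁ A t γ hγ hsp Δ hΔ ht M hM hΔM
  set Z := M * Δ with hZ
  have hZM : M ≤ Z := le_mul_of_one_le_right hM0.le hΔ
  have hZ1 : 1 ≤ Z := hM1.trans hZM
  have hZ0 : 0 < Z := by linarith
  have hZΔ : 168 * Δ ≤ Z := by rw [hZ]; gcongr
  set K := 24 * Δ / M with hK
  have hK0 : 0 ≤ K := by positivity
  have hKΔ : K ≤ 24 * Δ := div_le_self (by positivity) hM1
  have hd1 : 1 ≤ d := by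
    by_contra hc
    have : d ^ 6 < 1 := pow_lt_one₀ hd (not_le.mp hc) (by norm_num)
    linarith
  -- A length at least K² that also lies in the long range, since d⁴ = Δ^{2/3}; √X is then of order
  -- K + d², which gives the factor Δ/M + d².
  set X := K ^ 2 + 168 * d ^ 4 with hX
  have hd4 : 1 ≤ d ^ 4 := one_le_pow₀ hd1
  have hXd : 168 * d ^ 4 ≤ X := by have := sq_nonneg K; linarith
  have hX168 : 168 ≤ X := by linarith
  have hX3 : (24 * Δ) ^ 2 ≤ X ^ 3 := by
    calc (24 * Δ) ^ 2 = 576 * (d ^ 4) ^ 3 := by rw [← hdΔ]; ring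
      _ ≤ 4741632 * (d ^ 4) ^ 3 := by gcongr; norm_num
      _ = (168 * d ^ 4) ^ 3 := by ring
      _ ≤ _ := by gcongr
  have hK2 : K ^ 2 ≤ 144 * Δ := by
    rw [hK, div_pow, div_le_iff₀ (by positivity)]
    have : Δ * (4 * Δ) ≤ Δ * M ^ 2 := by gcongr
    linarith
  have hXZ : X ≤ 2 * Z := by
    have : d ^ 4 ≤ Δ := by rw [← hdΔ]; exact pow_le_pow_right₀ hd1 (by norm_num)
    linarith
  have hsq := h₂ A t γ hγ K Z hK0 (by linarith) hZ1
  have hlong := h₃ A t γ hγ hsp Δ hΔ ht X hX168 hX3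
  rw [← hqQ] at hdual hlong
  set G := ∑ r ∈ A, γ r with hG
  have hG0 : 0 ≤ G := Finset.sum_nonneg fun r _ => hγ r
  set y := zetaEnergy A t γ K with hy
  set E := Z ^ (ε / 2) with hE
  have hE1 : 1 ≤ E := Real.one_le_rpow hZ1 (by positivity)
  set B := C₂ * C₃ * 2 ^ (ε / 2) with hB
  have hy2 : y ^ 2 ≤ B * E ^ 2 * (G ^ 2 * (G ^ 2 + X * q ^ 2)) := by
    have hXε : X ^ (ε / 2) ≤ 2 ^ (ε / 2) * E := by
      rw [hE, ← Real.mul_rpow (by norm_num) hZ0.le]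
      gcongr
    calc y ^ 2 ≤ G ^ 2 * (C₂ * E * zetaEnergy A t γ (K ^ 2)) := hsq
      _ ≤ G ^ 2 * (C₂ * E * (C₃ * (2 ^ (ε / 2) * E) * (G ^ 2 + X * q ^ 2))) := by
          gcongr
          refine (zetaEnergy_mono (L := X) (by rw [hX]; linarith)).trans (hlong.trans ?_)
          gcongr
      _ = _ := by rw [hB]; ring
  set Y := G ^ 2 + (Δ / M + d ^ 2) * (G * q) with hY
  have hΔM0 : 0 ≤ Δ / M := by positivity
  have hY0 : 0 ≤ Y := by positivity
  have hYsq : G ^ 2 * (G ^ 2 + X * q ^ 2) ≤ 576 * Y ^ 2 := by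
    have e1 : K = 24 * (Δ / M) := by rw [hK]; ring
    rw [hX, hY, e1]
    have p1 : 0 ≤ G ^ 2 * ((Δ / M + d ^ 2) * (G * q)) := by positivity
    have p2 : 0 ≤ (Δ / M) * d ^ 2 * (G * q) ^ 2 := by positivity
    have p3 : 0 ≤ d ^ 4 * (G * q) ^ 2 := by positivity
    have p4 : 0 ≤ G ^ 4 := by positivity
    have e2 : 576 * (G ^ 2 + (Δ / M + d ^ 2) * (G * q)) ^ 2 -
        G ^ 2 * (G ^ 2 + ((24 * (Δ / M)) ^ 2 + 168 * d ^ 4) * q ^ 2) =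
        575 * G ^ 4 + 1152 * (G ^ 2 * ((Δ / M + d ^ 2) * (G * q))) +
        1152 * ((Δ / M) * d ^ 2 * (G * q) ^ 2) + 408 * (d ^ 4 * (G * q) ^ 2) := by ring
    linarith
  have hyY : y ≤ C₄ * E * Y := by
    refine le_of_sq_le_sq ?_ (by positivity)
    calc y ^ 2 ≤ B * E ^ 2 * (576 * Y ^ 2) := hy2.trans (by gcongr)
      _ ≤ B ^ 2 * E ^ 2 * (576 * Y ^ 2) := by
          gcongr
          exact le_self_pow₀ hC₄1 (by norm_num)
      _ = _ := by rw [hC₄]; ring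
  have hME : M ^ (ε / 2) ≤ E := by rw [hE]; gcongr
  calc zetaEnergy A t γ M ≤ C₁ * M ^ (ε / 2) * (M * q ^ 2 + y) := hdual
    _ ≤ C₁ * E * (C₄ * E * (M * q ^ 2) + C₄ * E * Y) := by
        have h9 : 0 ≤ M * q ^ 2 := by positivity
        have hy0 : 0 ≤ y := zetaEnergy_nonneg hγ K
        have : 1 ≤ C₄ * E := one_le_mul_of_one_le_of_one_le (by linarith) hE1
        have h10 : M * q ^ 2 ≤ C₄ * E * (M * q ^ 2) := le_mul_of_one_le_left h9 this
        gcongr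
    _ = C₁ * C₄ * (E * E) * (G ^ 2 + M * q ^ 2 + (Δ / M + d ^ 2) * (G * q)) := by
        rw [hY]; ring
    _ = _ := by
        have : Z ^ ε = E * E := by
          rw [hE, ← Real.rpow_add hZ0]; congr 1; ring
        rw [this]

/-- The optimal length of the dual sum. -/
lemma exists_optimal_length {N d g p : ℝ} (hN : 1 ≤ N) (hd : 1 ≤ d) (hp : 0 < p) (hpg : p ≤ g) :
    ∃ M : ℝ, 168 ≤ M ∧ 2 * N ≤ M ∧ 4 * d ^ 6 ≤ M ^ 2 ∧ M ≤ 168 * (N * d ^ 6) ∧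
      (g ^ 2) ^ 2 + M * (p ^ 2) ^ 2 + (d ^ 6 / M + d ^ 2) * (g ^ 2 * p ^ 2) ≤
        171 * (g ^ 4 + N * p ^ 4 + d ^ 3 * (g * p ^ 3)) := by
  have hg : 0 < g := lt_of_lt_of_le hp hpg
  have hd3 : 1 ≤ d ^ 3 := one_le_pow₀ hd
  have hd6 : d ^ 3 ≤ d ^ 6 := pow_le_pow_right₀ hd (by norm_num)
  -- With d⁶ = Δ, this balances M p⁴ against (Δ/M) g² p². The cap at d⁶ keeps M polynomial in N and
  -- Δ; once it is reached, Δ/M ≤ 1 and p ≤ g absorbs that term into g⁴.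
  set M₀ := d ^ 3 * (g / p) with hM₀
  have hM₀d : d ^ 3 ≤ M₀ := le_mul_of_one_le_right (by positivity) ((one_le_div hp).mpr hpg)
  set m := min M₀ (d ^ 6) with hm
  have hmd : d ^ 3 ≤ m := le_min hM₀d hd6
  set M := 168 * max N m with hM
  have hNM : N ≤ max N m := le_max_left _ _
  have hmM : m ≤ max N m := le_max_right _ _
  have hM1 : 168 ≤ M := by linarith
  have hM0 : 0 < M := by linarith
  have hdM : d ^ 3 ≤ M := by linarith
  have hmM' : m ≤ M := by linarith
  refine ⟨M, hM1, by linarith, ?_, ?_, ?_⟩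
  · have h1 : 2 * d ^ 3 ≤ M := by linarith
    calc 4 * d ^ 6 = (2 * d ^ 3) ^ 2 := by ring
      _ ≤ M ^ 2 := by gcongr
  · rw [hM]
    gcongr
    refine max_le (le_mul_of_one_le_right (by linarith) (by linarith)) ?_
    exact (min_le_right _ _).trans (le_mul_of_one_le_left (by positivity) hN)
  · set T := d ^ 3 * (g * p ^ 3) with hT
    have hT0 : 0 ≤ T := by positivity
    have hM₀T : M₀ * p ^ 4 = T := by rw [hM₀, hT]; field_simp
    have hNp : 0 ≤ N * p ^ 4 := by positivity
    have hg4 : 0 ≤ g ^ 4 := by positivity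
    have a1 : M * p ^ 4 ≤ 168 * (N * p ^ 4 + T) := by
      have : max N m ≤ N + M₀ := max_le (by linarith) (by
        have := min_le_left M₀ (d ^ 6); linarith)
      calc M * p ^ 4 ≤ 168 * (N + M₀) * p ^ 4 := by rw [hM]; gcongr
        _ = 168 * (N * p ^ 4 + M₀ * p ^ 4) := by ring
        _ = _ := by rw [hM₀T]
    have a2 : d ^ 6 / M * (g ^ 2 * p ^ 2) ≤ g ^ 4 + T := by
      rcases le_total M₀ (d ^ 6) with h | h
      · rw [min_eq_left h] at hm
        have h1 : d ^ 6 / M * (g ^ 2 * p ^ 2) ≤ d ^ 6 / M₀ * (g ^ 2 * p ^ 2) := by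
          have : 0 < M₀ := by positivity
          gcongr
          linarith
        have h2 : d ^ 6 / M₀ * (g ^ 2 * p ^ 2) = T := by rw [hM₀, hT]; field_simp
        linarith
      · rw [min_eq_right h] at hm
        have h1 : d ^ 6 / M ≤ 1 := by rw [div_le_one hM0]; linarith
        have h2 : g ^ 2 * p ^ 2 ≤ g ^ 4 := by
          calc g ^ 2 * p ^ 2 ≤ g ^ 2 * g ^ 2 := by gcongr
            _ = g ^ 4 := by ring
        have h3 : d ^ 6 / M * (g ^ 2 * p ^ 2) ≤ 1 * (g ^ 2 * p ^ 2) := by gcongr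
        linarith
    have a3 : d ^ 2 * (g ^ 2 * p ^ 2) ≤ g ^ 4 + T := by
      -- The term is at most g⁴ if dp ≤ g, and otherwise one factor g is traded for dp.
      rcases le_total (d * p) g with h | h
      · have h1 : (d * p) ^ 2 * g ^ 2 ≤ g ^ 2 * g ^ 2 := by gcongr
        linarith
      · have h1 : g * (g * (d ^ 2 * p ^ 2)) ≤ d * p * (g * (d ^ 2 * p ^ 2)) := by gcongr
        rw [hT]
        linarith
    have e1 : (g ^ 2) ^ 2 + M * (p ^ 2) ^ 2 + (d ^ 6 / M + d ^ 2) * (g ^ 2 * p ^ 2) =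
        g ^ 4 + M * p ^ 4 + d ^ 6 / M * (g ^ 2 * p ^ 2) + d ^ 2 * (g ^ 2 * p ^ 2) := by ring
    rw [e1]
    linarith

lemma sum_sq_le_sq_sum_of_nonneg {ι : Type*} (A : Finset ι) (γ : ι → ℝ) (hγ : ∀ r, 0 ≤ γ r) :
    ∑ r ∈ A, γ r ^ 2 ≤ (∑ r ∈ A, γ r) ^ 2 := by
  rw [sq (∑ r ∈ A, γ r), Finset.sum_mul]
  refine Finset.sum_le_sum fun r hr => ?_
  rw [sq]
  exact mul_le_mul_of_nonneg_left (Finset.single_le_sum (fun s _ => hγ s) hr) (hγ r)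

/-- The bound for partial sums of arbitrary length. -/
lemma exists_zetaEnergy_le {ε : ℝ} (hε : 0 < ε) : ∃ C : ℝ, 1 ≤ C ∧
    ∀ {ι : Type} (A : Finset ι) (t γ : ι → ℝ), (∀ r, 0 ≤ γ r) →
      (∀ r ∈ A, ∀ s ∈ A, r ≠ s → 1 ≤ |t r - t s|) → ∀ Δ : ℝ, 1 ≤ Δ →
      (∀ r ∈ A, ∀ s ∈ A, |t r - t s| ≤ Δ) → ∀ N : ℝ, 1 ≤ N →
      zetaEnergy A t γ (2 * N) ≤ C * (N * Δ) ^ ε *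
        ((∑ r ∈ A, γ r) ^ 2 + N * ∑ r ∈ A, γ r ^ 2 + Δ ^ (1 / 2 : ℝ) *
          (((∑ r ∈ A, γ r) ^ 2) ^ (1 / 4 : ℝ) * (∑ r ∈ A, γ r ^ 2) ^ (3 / 4 : ℝ))) := by
  obtain ⟨C₁, hC₁, h₁⟩ := exists_zetaEnergy_le_short (ε := ε / 2) (by positivity)
  have h168 : (1 : ℝ) ≤ 168 ^ (ε / 2) := Real.one_le_rpow (by norm_num) (by positivity)
  refine ⟨C₁ * 168 ^ (ε / 2) * 171, one_le_mul_of_one_le_of_one_le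
    (one_le_mul_of_one_le_of_one_le hC₁ h168) (by norm_num), ?_⟩
  intro ι A t γ hγ hsp Δ hΔ ht N hN
  have hΔ0 : 0 < Δ := by linarith
  set G := ∑ r ∈ A, γ r with hG
  set Q := ∑ r ∈ A, γ r ^ 2 with hQ
  have hG0 : 0 ≤ G := Finset.sum_nonneg fun r _ => hγ r
  have hQ0 : 0 ≤ Q := Finset.sum_nonneg fun r _ => sq_nonneg _
  have hQG : Q ≤ G ^ 2 := sum_sq_le_sq_sum_of_nonneg A γ hγ
  -- If Q = 0 all weights on A vanish; otherwise the quotient g/p in the optimal length makes sense.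
  rcases hQ0.eq_or_lt with hQz | hQpos
  · have hz : zetaEnergy A t γ (2 * N) = 0 := by
      refine Finset.sum_eq_zero fun r hr => Finset.sum_eq_zero fun s _ => ?_
      have := (Finset.sum_eq_zero_iff_of_nonneg (fun r _ => sq_nonneg (γ r))).mp hQz.symm r hr
      rw [pow_eq_zero_iff (by norm_num)] at this
      rw [this, zero_mul, zero_mul]
    rw [hz]
    positivity
  set q := Real.sqrt Q with hq
  have hq2 : q ^ 2 = Q := Real.sq_sqrt hQ0
  have hq0 : 0 < q := Real.sqrt_pos.mpr hQpos
  have hqG : q ≤ G := le_of_sq_le_sq (by rw [hq2]; exact hQG) hG0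
  set p := Real.sqrt q with hp
  set g := Real.sqrt G with hg
  have hp0 : 0 < p := Real.sqrt_pos.mpr hq0
  have hp2 : p ^ 2 = q := Real.sq_sqrt hq0.le
  have hg2 : g ^ 2 = G := Real.sq_sqrt hG0
  have hg0 : 0 ≤ g := Real.sqrt_nonneg _
  set d := Δ ^ (1 / 6 : ℝ) with hd
  have hd1 : 1 ≤ d := Real.one_le_rpow hΔ (by norm_num)
  have hd6 : d ^ 6 = Δ := by
    rw [hd, ← Real.rpow_natCast, ← Real.rpow_mul hΔ0.le]; norm_num
  obtain ⟨M, hM1, hM2, hM3, hM4, hM5⟩ := exists_optimal_length hN hd1 hp0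
    (Real.sqrt_le_sqrt hqG)
  have hM0 : 0 < M := by linarith
  rw [hd6] at hM3 hM4 hM5
  rw [hp2, hg2] at hM5
  have hmain := h₁ A t γ hγ hsp Δ hΔ ht M d q hM1 hM3 (by linarith) hd6 hq0.le hq2
  have e1 : Δ ^ (1 / 2 : ℝ) = d ^ 3 := by
    rw [hd, ← Real.rpow_natCast, ← Real.rpow_mul hΔ0.le]; norm_num
  have e2 : (G ^ 2) ^ (1 / 4 : ℝ) = g := by
    rw [← hg2, ← pow_mul, ← Real.rpow_natCast, ← Real.rpow_mul hg0]; norm_num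
  have e3 : Q ^ (3 / 4 : ℝ) = p ^ 3 := by
    rw [← hq2, ← hp2, ← pow_mul, ← Real.rpow_natCast, ← Real.rpow_mul hp0.le,
      ← Real.rpow_natCast]
    norm_num
  rw [e1, e2, e3]
  have e4 : g ^ 4 = G ^ 2 := by rw [← hg2]; ring
  have e5 : p ^ 4 = Q := by rw [← hq2, ← hp2]; ring
  rw [e4, e5] at hM5
  have hND : 1 ≤ N * Δ := one_le_mul_of_one_le_of_one_le hN hΔ
  have hε1 : (M * Δ) ^ (ε / 2) ≤ 168 ^ (ε / 2) * (N * Δ) ^ ε := by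
    have h3 : M * Δ ≤ 168 * (N * Δ) ^ 2 := by
      have h4 : N * Δ * Δ ≤ N * Δ * (N * Δ) := by
        gcongr
        exact le_mul_of_one_le_left hΔ0.le hN
      have h5 : M * Δ ≤ 168 * (N * Δ) * Δ := by gcongr
      linarith
    calc (M * Δ) ^ (ε / 2) ≤ (168 * (N * Δ) ^ 2) ^ (ε / 2) := by gcongr
      _ = 168 ^ (ε / 2) * (N * Δ) ^ ε := by
          rw [Real.mul_rpow (by norm_num) (by positivity), ← Real.rpow_natCast (N * Δ),
            ← Real.rpow_mul (by linarith)]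
          congr 2
          push_cast
          ring
  calc zetaEnergy A t γ (2 * N) ≤ zetaEnergy A t γ M := zetaEnergy_mono hM2
    _ ≤ C₁ * (M * Δ) ^ (ε / 2) *
        (G ^ 2 + M * q ^ 2 + (Δ / M + d ^ 2) * (G * q)) := hmain
    _ ≤ C₁ * (168 ^ (ε / 2) * (N * Δ) ^ ε) *
        (171 * (G ^ 2 + N * Q + d ^ 3 * (g * p ^ 3))) := by gcongr
    _ = _ := by ring

end Bounds

/-! ### Localization to windows -/

section Windows

lemma dirichletPoly_eq_twistSum (a : ℕ → ℂ) {N : ℝ} (hN : 1 ≤ N) (τ : ℝ) :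
    dirichletPoly a N τ =
      twistSum (Finset.Icc ⌈N⌉₊ ⌊2 * N⌋₊) (fun n => a n * (invSqrt n : ℂ)) τ := by
  unfold dirichletPoly twistSum
  refine Finset.sum_congr rfl fun n hn => ?_
  have hn0 : 0 < n := lt_of_lt_of_le (Nat.ceil_pos.mpr (by linarith)) (Finset.mem_Icc.mp hn).1
  have hnR : (0 : ℝ) < n := by exact_mod_cast hn0
  have hnC : (n : ℂ) ≠ 0 := by exact_mod_cast hn0.ne'
  rw [mul_assoc, Complex.cpow_add _ _ hnC]
  congr 2
  · unfold invSqrt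
    rw [Real.sqrt_eq_rpow, ← Real.rpow_neg hnR.le, Complex.ofReal_cpow hnR.le]
    push_cast
    rfl
  · rw [Complex.cpow_def_of_ne_zero hnC, ← Complex.natCast_log]
    congr 1
    push_cast
    ring

variable {R : ℕ} {t γ : Fin R → ℝ}

/-- The indices `r` with `t_r ∈ [j L, (j + 1) L)`. -/
noncomputable def window (t : Fin R → ℝ) (L : ℝ) (j : ℤ) : Finset (Fin R) :=
  Finset.univ.filter fun r => ⌊t r / L⌋ = j

lemma abs_sub_lt_of_mem_window {L : ℝ} (hL : 0 < L) {j : ℤ} {r s : Fin R}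
    (hr : r ∈ window t L j) (hs : s ∈ window t L j) : |t r - t s| < L := by
  have h1 := (Finset.mem_filter.mp hr).2
  have h2 := (Finset.mem_filter.mp hs).2
  have h3 := Int.abs_sub_lt_one_of_floor_eq_floor (h1.trans h2.symm)
  rwa [← sub_div, abs_div, abs_of_pos hL, div_lt_one hL] at h3

lemma sum_eq_sum_window (L : ℝ) (f : Fin R → ℝ) :
    ∑ r, f r = ∑ j ∈ Finset.univ.image (fun r => ⌊t r / L⌋), ∑ r ∈ window t L j, f r :=
  (Finset.sum_fiberwise_of_maps_to (fun r _ => Finset.mem_image_of_mem _ (Finset.mem_univ r)) f).symm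

/-- Pairs inside one window are counted on the right: if L = Δ they are close, and if L = 1
well-spacing makes them diagonal. -/
lemma sum_window_sq_le_localizedCount (hγ : ∀ r, 0 ≤ γ r) (ht : WellSpaced t) {Δ L : ℝ}
    (hΔ : 0 ≤ Δ) (hL : L = max Δ 1) :
    ∑ j ∈ Finset.univ.image (fun r => ⌊t r / L⌋), (∑ r ∈ window t L j, γ r) ^ 2 ≤
      localizedCount Δ t γ := by
  have hL0 : 0 < L := by rw [hL]; exact lt_of_lt_of_le one_pos (le_max_right _ _)
  unfold localizedCount
  rw [Finset.sum_filter, Fintype.sum_prod_type, sum_eq_sum_window (t := t) L]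
  refine Finset.sum_le_sum fun j _ => ?_
  rw [sq, Finset.sum_mul_sum]
  refine Finset.sum_le_sum fun r hr => ?_
  have hterm : ∀ s, 0 ≤ if |t r - t s| ≤ Δ then γ r * γ s else 0 := fun s => by
    split_ifs
    · exact mul_nonneg (hγ r) (hγ s)
    · exact le_rfl
  refine le_trans (Finset.sum_le_sum fun s hs => ?_)
    (Finset.sum_le_sum_of_subset_of_nonneg (Finset.subset_univ (window t L j))
      fun s _ _ => hterm s)
  have h1 := abs_sub_lt_of_mem_window hL0 hr hs
  rw [if_pos]
  rw [hL] at h1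
  rcases lt_max_iff.mp h1 with h | h
  · exact h.le
  · have : r = s := by
      by_contra hne
      exact absurd (ht r s hne) (not_le.mpr h)
    rw [this, sub_self, abs_zero]
    exact hΔ

/-- Each index has at most three neighbours, itself included. -/
lemma sum_near_le (W : Finset ℤ) (h : ℤ → ℝ) (hh : ∀ j, 0 ≤ h j) :
    ∑ i ∈ W, ∑ j ∈ W, (if |i - j| ≤ 1 then (h i + h j) / 2 else 0) ≤ 3 * ∑ j ∈ W, h j := by
  have key : ∑ i ∈ W, ∑ j ∈ W, (if |i - j| ≤ 1 then h i else 0) ≤ 3 * ∑ j ∈ W, h j := by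
    rw [Finset.mul_sum]
    refine Finset.sum_le_sum fun i _ => ?_
    rw [← Finset.sum_filter, Finset.sum_const, nsmul_eq_mul]
    refine mul_le_mul_of_nonneg_right ?_ (hh i)
    have hsub : W.filter (fun j => |i - j| ≤ 1) ⊆ Finset.Icc (i - 1) (i + 1) := by
      intro j hj
      have := abs_le.mp (Finset.mem_filter.mp hj).2
      rw [Finset.mem_Icc]
      omega
    have := Finset.card_le_card hsub
    rw [Int.card_Icc] at this
    have h3 : (W.filter (fun j => |i - j| ≤ 1)).card ≤ 3 := by omega
    exact_mod_cast h3
  have key2 : ∑ i ∈ W, ∑ j ∈ W, (if |i - j| ≤ 1 then h j else 0) ≤ 3 * ∑ j ∈ W, h j := by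
    rw [Finset.sum_comm]
    simp_rw [abs_sub_comm]
    exact key
  have : ∑ i ∈ W, ∑ j ∈ W, (if |i - j| ≤ 1 then (h i + h j) / 2 else 0) =
      (∑ i ∈ W, ∑ j ∈ W, (if |i - j| ≤ 1 then h i else 0) +
      ∑ i ∈ W, ∑ j ∈ W, (if |i - j| ≤ 1 then h j else 0)) / 2 := by
    rw [← Finset.sum_add_distrib, Finset.sum_div]
    refine Finset.sum_congr rfl fun i _ => ?_
    rw [← Finset.sum_add_distrib, Finset.sum_div]
    refine Finset.sum_congr rfl fun j _ => ?_
    split_ifs <;> ring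
  linarith

/-- Localization: the sum over close pairs is controlled by the energies of the windows. -/
lemma localizedSum_le_sum_window (hγ : ∀ r, 0 ≤ γ r) {a : ℕ → ℂ} (ha : ∀ n, ‖a n‖ ≤ 1) {N Δ L : ℝ}
    (hN : 1 ≤ N) (hL0 : 0 < L) (hΔL : Δ ≤ L) :
    localizedSum a N Δ t γ ≤ 3 * ∑ j ∈ Finset.univ.image (fun r => ⌊t r / L⌋),
      zetaEnergy (window t L j) t γ (2 * N) := by
  set W := Finset.univ.image (fun r => ⌊t r / L⌋) with hW
  set X := Finset.Icc ⌈N⌉₊ ⌊2 * N⌋₊ with hX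
  set c : ℕ → ℂ := fun n => a n * (invSqrt n : ℂ) with hc
  have hXsub : X ⊆ Finset.Icc 1 ⌊2 * N⌋₊ :=
    Finset.Icc_subset_Icc_left (Nat.one_le_ceil_iff.mpr (by linarith))
  have hcb : ∀ n ∈ X, ‖c n‖ ≤ invSqrt n := fun n _ => by
    rw [hc, norm_mul, Complex.norm_real, Real.norm_of_nonneg (invSqrt_nonneg n)]
    exact mul_le_of_le_one_left (invSqrt_nonneg n) (ha n)
  refine le_trans ?_ (sum_near_le W (fun j => zetaEnergy (window t L j) t γ (2 * N))
    fun j => zetaEnergy_nonneg hγ _)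
  have h1 : localizedSum a N Δ t γ = ∑ i ∈ W, ∑ j ∈ W, ∑ r ∈ window t L i, ∑ s ∈ window t L j,
      if |t r - t s| ≤ Δ then γ r * γ s * ‖twistSum X c (t r - t s)‖ ^ 2 else 0 := by
    unfold localizedSum
    rw [Finset.sum_filter, Fintype.sum_prod_type, sum_eq_sum_window (t := t) L]
    refine Finset.sum_congr rfl fun i _ => ?_
    rw [Finset.sum_comm (s := W)]
    refine Finset.sum_congr rfl fun r _ => ?_
    rw [sum_eq_sum_window (t := t) L]
    refine Finset.sum_congr rfl fun j _ => Finset.sum_congr rfl fun s _ => ?_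
    rw [dirichletPoly_eq_twistSum a hN]
  rw [h1]
  refine Finset.sum_le_sum fun i _ => Finset.sum_le_sum fun j _ => ?_
  have hterm : ∀ r s, 0 ≤ γ r * γ s * ‖twistSum X c (t r - t s)‖ ^ 2 := fun r s =>
    mul_nonneg (mul_nonneg (hγ r) (hγ s)) (by positivity)
  split_ifs with hij
  · refine le_trans ?_ (crossEnergy_le_half_add (A := window t L i) (B := window t L j) (t := t)
      (γ := γ) hXsub hcb invSqrt_nonneg)
    refine Finset.sum_le_sum fun r _ => Finset.sum_le_sum fun s _ => ?_
    split_ifs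
    · exact le_rfl
    · exact hterm r s
  · refine Finset.sum_nonpos fun r hr => Finset.sum_nonpos fun s hs => ?_
    rw [if_neg]
    intro hrs
    apply hij
    have hr' := (Finset.mem_filter.mp hr).2
    have hs' := (Finset.mem_filter.mp hs).2
    have h2 : |t r / L - t s / L| ≤ 1 := by
      rw [← sub_div, abs_div, abs_of_pos hL0, div_le_one hL0]
      linarith
    have h3 := abs_le.mp h2
    have a1 := Int.floor_le (t r / L)
    have a2 := Int.lt_floor_add_one (t r / L)
    have a3 := Int.floor_le (t s / L)
    have a4 := Int.lt_floor_add_one (t s / L)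
    rw [hr'] at a1 a2
    rw [hs'] at a3 a4
    have b1 : (i : ℝ) < ((j + 2 : ℤ) : ℝ) := by push_cast; linarith [h3.2]
    have b2 : (j : ℝ) < ((i + 2 : ℤ) : ℝ) := by push_cast; linarith [h3.1]
    have b1' : i < j + 2 := by exact_mod_cast b1
    have b2' : j < i + 2 := by exact_mod_cast b2
    rw [abs_le]
    omega

/-- Hölder's inequality with exponents 4 and 4/3. -/
lemma sum_rpow_mul_rpow_le {κ : Type*} (W : Finset κ) (I Q : κ → ℝ) (hI : ∀ j, 0 ≤ I j)
    (hQ : ∀ j, 0 ≤ Q j) : ∑ j ∈ W, I j ^ (1 / 4 : ℝ) * Q j ^ (3 / 4 : ℝ) ≤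
      (∑ j ∈ W, I j) ^ (1 / 4 : ℝ) * (∑ j ∈ W, Q j) ^ (3 / 4 : ℝ) := by
  have hpq : Real.HolderConjugate 4 (4 / 3) := by
    rw [Real.holderConjugate_iff]; norm_num
  have h := Real.inner_le_Lp_mul_Lq_of_nonneg W hpq
    (fun j _ => Real.rpow_nonneg (hI j) (1 / 4)) (fun j _ => Real.rpow_nonneg (hQ j) (3 / 4))
  have e1 : ∀ j, (I j ^ (1 / 4 : ℝ)) ^ (4 : ℝ) = I j := fun j => by
    rw [← Real.rpow_mul (hI j)]; norm_num
  have e2 : ∀ j, (Q j ^ (3 / 4 : ℝ)) ^ (4 / 3 : ℝ) = Q j := fun j => by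
    rw [← Real.rpow_mul (hQ j)]; norm_num
  simp_rw [e1, e2] at h
  rwa [show (1 / (4 / 3) : ℝ) = 3 / 4 by norm_num] at h

lemma l2Norm_sq (γ : Fin R → ℝ) : l2Norm γ ^ 2 = ∑ r, γ r ^ 2 :=
  Real.sq_sqrt (Finset.sum_nonneg fun _ _ => sq_nonneg _)

/-- The localized estimate for long Dirichlet polynomials. -/
lemma exists_localizedSum_le_of_rpow_le {ε : ℝ} (hε : 0 < ε) : ∃ C : ℝ, 0 < C ∧
    ∀ (N Δ : ℝ) (R : ℕ) (t γ : Fin R → ℝ) (a : ℕ → ℂ), 1 ≤ N → 0 ≤ Δ → WellSpaced t →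
      (∀ r, 0 ≤ γ r) → (∀ n, ‖a n‖ ≤ 1) → Δ ^ (2 / 3 : ℝ) ≤ N →
      localizedSum a N Δ t γ ≤ C * N ^ ε * (localizedCount Δ t γ + N * l2Norm γ ^ 2) := by
  obtain ⟨C, hC, h⟩ := exists_zetaEnergy_le_of_sq_le_cube hε
  refine ⟨3 * (C * 336 ^ ε * 336), by positivity, ?_⟩
  intro N Δ R t γ a hN hΔ ht hγ ha hΔN
  have hN0 : 0 < N := by linarith
  obtain ⟨L, hL⟩ : ∃ L, L = max Δ 1 := ⟨_, rfl⟩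
  have hL1 : 1 ≤ L := hL ▸ le_max_right _ _
  have hL0 : 0 < L := by linarith
  have hLN : L ^ 2 ≤ N ^ 3 := by
    rcases le_total Δ 1 with h1 | h1
    · rw [hL, max_eq_right h1, one_pow]; exact one_le_pow₀ hN
    · rw [hL, max_eq_left h1]
      calc Δ ^ 2 = (Δ ^ (2 / 3 : ℝ)) ^ 3 := by
            rw [← Real.rpow_natCast, ← Real.rpow_natCast, ← Real.rpow_mul hΔ]; norm_num
        _ ≤ N ^ 3 := by gcongr
  have hwin : ∀ j, zetaEnergy (window t L j) t γ (2 * N) ≤ C * 336 ^ ε * 336 * N ^ ε *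
      ((∑ r ∈ window t L j, γ r) ^ 2 + N * ∑ r ∈ window t L j, γ r ^ 2) := by
    intro j
    have hQ0 : 0 ≤ ∑ r ∈ window t L j, γ r ^ 2 := Finset.sum_nonneg fun r _ => sq_nonneg _
    -- Lengthening 2N to 336N meets both requirements of the long bound, 336N ≥ 168 and (24L)² ≤
    -- (336N)³, at the cost of a constant.
    have h1 := h (window t L j) t γ hγ (fun r _ s _ hrs => ht r s hrs) L hL1
      (fun r hr s hs => (abs_sub_lt_of_mem_window hL0 hr hs).le) (336 * N) (by linarith) (by
        have : 0 ≤ N ^ 3 := by positivity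
        nlinarith)
    refine (zetaEnergy_mono (by linarith)).trans (h1.trans ?_)
    rw [Real.mul_rpow (by norm_num) hN0.le]
    calc _ ≤ C * (336 ^ ε * N ^ ε) * (336 * ((∑ r ∈ window t L j, γ r) ^ 2 +
          N * ∑ r ∈ window t L j, γ r ^ 2)) := by
          gcongr
          have := sq_nonneg (∑ r ∈ window t L j, γ r)
          linarith
      _ = _ := by ring
  calc localizedSum a N Δ t γ ≤ _ :=
        localizedSum_le_sum_window hγ ha hN hL0 (hL ▸ le_max_left _ _)
    _ ≤ 3 * ∑ j ∈ Finset.univ.image (fun r => ⌊t r / L⌋), C * 336 ^ ε * 336 * N ^ ε *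
        ((∑ r ∈ window t L j, γ r) ^ 2 + N * ∑ r ∈ window t L j, γ r ^ 2) := by
        gcongr with j _
        exact hwin j
    _ = 3 * (C * 336 ^ ε * 336) * N ^ ε *
        (∑ j ∈ Finset.univ.image (fun r => ⌊t r / L⌋), (∑ r ∈ window t L j, γ r) ^ 2 +
          N * l2Norm γ ^ 2) := by
        rw [← Finset.mul_sum, Finset.sum_add_distrib, ← Finset.mul_sum, l2Norm_sq,
          sum_eq_sum_window (t := t) L (fun r => γ r ^ 2)]
        ring
    _ ≤ _ := by
        gcongr
        exact sum_window_sq_le_localizedCount hγ ht hΔ hL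

/-- The localized estimate for Dirichlet polynomials of arbitrary length. -/
lemma exists_localizedSum_le {ε : ℝ} (hε : 0 < ε) : ∃ C : ℝ, 0 < C ∧
    ∀ (N Δ : ℝ) (R : ℕ) (t γ : Fin R → ℝ) (a : ℕ → ℂ), 1 ≤ N → 1 ≤ Δ → WellSpaced t →
      (∀ r, 0 ≤ γ r) → (∀ n, ‖a n‖ ≤ 1) →
      localizedSum a N Δ t γ ≤ C * (N * Δ) ^ ε * (localizedCount Δ t γ + N * l2Norm γ ^ 2 +
        Δ ^ (1 / 2 : ℝ) * localizedCount Δ t γ ^ (1 / 4 : ℝ) * l2Norm γ ^ (3 / 2 : ℝ)) := by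
  obtain ⟨C, hC, h⟩ := exists_zetaEnergy_le hε
  refine ⟨3 * C, by positivity, ?_⟩
  intro N Δ R t γ a hN hΔ ht hγ ha
  have hN0 : 0 < N := by linarith
  have hΔ0 : 0 < Δ := by linarith
  set W := Finset.univ.image (fun r => ⌊t r / Δ⌋) with hW
  set I : ℤ → ℝ := fun j => (∑ r ∈ window t Δ j, γ r) ^ 2 with hI
  set Q : ℤ → ℝ := fun j => ∑ r ∈ window t Δ j, γ r ^ 2 with hQ
  have hI0 : ∀ j, 0 ≤ I j := fun j => sq_nonneg _
  have hQ0 : ∀ j, 0 ≤ Q j := fun j => Finset.sum_nonneg fun r _ => sq_nonneg _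
  have hIsum : ∑ j ∈ W, I j ≤ localizedCount Δ t γ :=
    sum_window_sq_le_localizedCount hγ ht hΔ0.le (max_eq_left hΔ).symm
  have hQsum : ∑ j ∈ W, Q j = l2Norm γ ^ 2 := by
    rw [l2Norm_sq, sum_eq_sum_window (t := t) Δ (fun r => γ r ^ 2)]
  have hl0 : 0 ≤ l2Norm γ := Real.sqrt_nonneg _
  have hl : l2Norm γ ^ (3 / 2 : ℝ) = (l2Norm γ ^ 2) ^ (3 / 4 : ℝ) := by
    rw [← Real.rpow_natCast, ← Real.rpow_mul hl0]; norm_num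
  have hIs0 : 0 ≤ ∑ j ∈ W, I j := Finset.sum_nonneg fun j _ => hI0 j
  calc localizedSum a N Δ t γ ≤ _ := localizedSum_le_sum_window hγ ha hN hΔ0 le_rfl
    _ ≤ 3 * ∑ j ∈ W, C * (N * Δ) ^ ε *
        (I j + N * Q j + Δ ^ (1 / 2 : ℝ) * (I j ^ (1 / 4 : ℝ) * Q j ^ (3 / 4 : ℝ))) := by
        gcongr with j _
        exact h (window t Δ j) t γ hγ (fun r _ s _ hrs => ht r s hrs) Δ hΔ
          (fun r hr s hs => (abs_sub_lt_of_mem_window hΔ0 hr hs).le) N hN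
    _ = 3 * C * (N * Δ) ^ ε * (∑ j ∈ W, I j + N * l2Norm γ ^ 2 +
        Δ ^ (1 / 2 : ℝ) * ∑ j ∈ W, I j ^ (1 / 4 : ℝ) * Q j ^ (3 / 4 : ℝ)) := by
        rw [← Finset.mul_sum, Finset.sum_add_distrib, Finset.sum_add_distrib, ← Finset.mul_sum,
          ← Finset.mul_sum, hQsum]
        ring
    _ ≤ 3 * C * (N * Δ) ^ ε * (∑ j ∈ W, I j + N * l2Norm γ ^ 2 + Δ ^ (1 / 2 : ℝ) *
        ((∑ j ∈ W, I j) ^ (1 / 4 : ℝ) * (l2Norm γ ^ 2) ^ (3 / 4 : ℝ))) := by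
        gcongr
        rw [← hQsum]
        exact sum_rpow_mul_rpow_le W I Q hI0 hQ0
    _ ≤ _ := by
        rw [hl, mul_assoc (Δ ^ (1 / 2 : ℝ))]
        gcongr

end Windows

theorem theorem16 (ε : ℝ) (hε : 0 < ε) :
    ∃ C : ℝ, 0 < C ∧
      ∀ (N T Δ : ℝ) (R : ℕ) (t γ : Fin R → ℝ) (a : ℕ → ℂ),
        1 ≤ N → 0 ≤ Δ →
        (∀ r, 1 ≤ t r ∧ t r ≤ T) → WellSpaced t → (∀ r, 0 < γ r) → (∀ n, ‖a n‖ ≤ 1) →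
        (Δ ^ (2 / 3 : ℝ) ≤ N →
          localizedSum a N Δ t γ ≤
            C * N ^ ε * (localizedCount Δ t γ + N * l2Norm γ ^ 2)) ∧
        localizedSum a N Δ t γ ≤
          C * (N * T) ^ ε *
            (localizedCount Δ t γ + N * l2Norm γ ^ 2 +
              Δ ^ (1 / 2 : ℝ) * localizedCount Δ t γ ^ (1 / 4 : ℝ) * l2Norm γ ^ (3 / 2 : ℝ)) := by
  obtain ⟨C₁, hC₁, h₁⟩ := exists_localizedSum_le_of_rpow_le hε
  obtain ⟨C₂, hC₂, h₂⟩ := exists_localizedSum_le hε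
  refine ⟨C₁ + C₂, by positivity, ?_⟩
  intro N T Δ R t γ a hN hΔ htT ht hγ ha
  have hγ' : ∀ r, 0 ≤ γ r := fun r => (hγ r).le
  have hN0 : 0 < N := by linarith
  have hI0 : 0 ≤ localizedCount Δ t γ :=
    Finset.sum_nonneg fun p _ => mul_nonneg (hγ' _) (hγ' _)
  have hl0 : 0 ≤ l2Norm γ := Real.sqrt_nonneg _
  have hlong : Δ ^ (2 / 3 : ℝ) ≤ N → localizedSum a N Δ t γ ≤
      (C₁ + C₂) * N ^ ε * (localizedCount Δ t γ + N * l2Norm γ ^ 2) := fun hΔN =>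
    (h₁ N Δ R t γ a hN hΔ ht hγ' ha hΔN).trans (by gcongr; linarith)
  refine ⟨hlong, ?_⟩
  -- Only a nonempty family forces T ≥ 1; for R = 0 both sides vanish.
  rcases Nat.eq_zero_or_pos R with rfl | hR
  · simp [localizedSum, localizedCount, l2Norm]
  have hT : 1 ≤ T := (htT ⟨0, hR⟩).1.trans (htT ⟨0, hR⟩).2
  -- For Δ ≤ 1 the long range is automatic, as Δ^{2/3} ≤ 1 ≤ N.
  rcases le_total Δ 1 with hΔ1 | hΔ1
  · refine (hlong ((Real.rpow_le_one hΔ hΔ1 (by norm_num)).trans hN)).trans ?_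
    have h3 : N ≤ N * T := le_mul_of_one_le_right hN0.le hT
    have h4 : 0 ≤ Δ ^ (1 / 2 : ℝ) * localizedCount Δ t γ ^ (1 / 4 : ℝ) *
        l2Norm γ ^ (3 / 2 : ℝ) := by positivity
    calc (C₁ + C₂) * N ^ ε * (localizedCount Δ t γ + N * l2Norm γ ^ 2)
        ≤ (C₁ + C₂) * (N * T) ^ ε * (localizedCount Δ t γ + N * l2Norm γ ^ 2) := by gcongr
      _ ≤ _ := mul_le_mul_of_nonneg_left (le_add_of_nonneg_right h4) (by positivity)
  -- All differences are at most T, so Δ can be replaced by min(Δ, T) without changing either sum;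
  -- this turns (NΔ)^ε into (NT)^ε.
  · have hiff : ∀ p : Fin R × Fin R, |t p.1 - t p.2| ≤ Δ ↔ |t p.1 - t p.2| ≤ min Δ T := by
      intro p
      rw [le_min_iff, iff_self_and]
      intro _
      have b1 := htT p.1
      have b2 := htT p.2
      rw [abs_le]
      constructor <;> linarith
    have e1 : localizedSum a N Δ t γ = localizedSum a N (min Δ T) t γ := by
      unfold localizedSum
      simp_rw [hiff]
    have e2 : localizedCount Δ t γ = localizedCount (min Δ T) t γ := by
      unfold localizedCount
      simp_rw [hiff]
    rw [e1, e2]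
    rw [e2] at hI0
    have hm : 1 ≤ min Δ T := le_min hΔ1 hT
    have hmT := min_le_right Δ T
    have hmΔ := min_le_left Δ T
    refine (h₂ N (min Δ T) R t γ a hN hm ht hγ' ha).trans ?_
    gcongr
    linarith
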